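/- Let $(M_1,g_1)$ and $(M_2,g_2)$ be smooth Riemannian manifolds (without boundary) of dimensions $n_1$ and $n_2$, and let $\rho_1:M_1\to(0,\infty)$ and $\rho_2:M_2\to(0,\infty)$ be smooth functions. Let $M={M_1}_{\rho_2}\!\times_{\rho_1}M_2$ be their doubly warped product, that is, $M_1\times M_2$ with the metric $g=(\rho_2\circ\pi_2)^2\,\pi_1^*g_1+(\rho_1\circ\pi_1)^2\,\pi_2^*g_2$, where $\pi_i:M_1\times M_2\to M_i$ are the projections, and put $n=n_1+n_2=\dim M$. Let $\mathbf{x}:M\to\tilde M$ be a (smooth) isometric immersion into a finite-dimensional Riemannian manifold $\tilde M$, with second fundamental form $\sigma(X,Y)=\tilde\nabla_XY-\nabla_XY$. For $p=(p_1,p_2)\in M$ let $T_pM_1$ and $T_pM_2$ be the tangent spaces at $p$ of the leaves $M_1\times\{p_2\}$ and $\{p_1\}\times M_2$, and write: * $\Delta_1$ and $\Delta_2$ at $p$ for the Laplacians of these two leaves with the metrics induced from $M$, namely $\rho_2(p_2)^2g_1$ and $\rho_1(p_1)^2g_2$, with the sign convention $\Delta\psi=-\operatorname{trace}\operatorname{Hess}\psi$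 (thus $\Delta_1=\rho_2(p_2)^{-2}\Delta_{g_1}$ and $\Delta_2=\rho_1(p_1)^{-2}\Delta_{g_2}$); * $H=\frac1n\operatorname{trace}\sigma$ for the mean curvature vector, and $H_i=\frac1{n_i}\sum_{a}\sigma(e_a,e_a)$, with $(e_a)$ a $g$-orthonormal basis of $T_pM_i$, for the partial mean curvature vectors; * $\tilde\tau(P)=\sum_{a<b}\tilde K(e_a\wedge e_b)$ for a subspace $P\subseteq T_{\mathbf{x}(p)}\tilde M$ with orthonormal basis $(e_a)$, where $\tilde K$ is the sectional curvature of $\tilde M$; subspaces of $T_pM$ are regarded as subspaces of $T_{\mathbf{x}(p)}\tilde M$ through $d\mathbf{x}$. Then at every point $p=(p_1,p_2)\in M$ $$n_2\frac{\Delta_1\rho_1}{\rho_1}+n_1\frac{\Delta_2\rho_2}{\rho_2}\le\frac{n^2}{4}\|H\|^2+\tilde\tau(T_pM)-\tilde\tau(T_pM_1)-\tilde\tau(T_pM_2).$$ Moreover, equality holds at every point of $M$ if and only if $\mathbf{x}$ is mixed totally geodesic (that is, $\sigma(X,Z)=0$ for all $p\in M$, $X\in T_pM_1$, $Z\in T_pM_2$)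 and $n_1H_1=n_2H_2$ at every point of $M$. -/

import Mathlib

open Bundle Set Filter
open scoped Manifold ContDiff Topology

noncomputable section

/-- A smooth Riemannian metric on a smooth manifold `M` modelled on `I`. -/
abbrev RiemMetric {E : Type*} [NormedAddCommGroup E] [NormedSpace ℝ E]
    {H : Type*} [TopologicalSpace H] (I : ModelWithCorners ℝ E H)
    (M : Type*) [TopologicalSpace M] [ChartedSpace H M] [IsManifold I ∞ M] :=
  ContMDiffRiemannianMetric I ∞ E (fun p : M => TangentSpace I p)

/-- The pullback `(u, v) ↦ B (A u) (A v)` of a bilinear form `B` under a linear map `A`. -/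
def pullbackForm {V W : Type*} [AddCommGroup V] [Module ℝ V] [TopologicalSpace V]
    [AddCommGroup W] [Module ℝ W] [TopologicalSpace W]
    (B : W →L[ℝ] W →L[ℝ] ℝ) (A : V →L[ℝ] W) : V →L[ℝ] V →L[ℝ] ℝ :=
  (A.precomp ℝ).comp (B.comp A)

@[simp]
theorem pullbackForm_apply {V W : Type*} [AddCommGroup V] [Module ℝ V] [TopologicalSpace V]
    [AddCommGroup W] [Module ℝ W] [TopologicalSpace W]
    (B : W →L[ℝ] W →L[ℝ] ℝ) (A : V →L[ℝ] W) (u v : V) :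
    pullbackForm B A u v = B (A u) (A v) := rfl

/-! ### Orthonormal frames and traces -/

section Frames

variable {E : Type*} [NormedAddCommGroup E] [NormedSpace ℝ E] [FiniteDimensional ℝ E]
  {H : Type*} [TopologicalSpace H] {I : ModelWithCorners ℝ E H}
  {M : Type*} [TopologicalSpace M] [ChartedSpace H M] [IsManifold I ∞ M]

/-- On a finite-dimensional space the unit ball of a scalar product is bounded. -/
theorem isVonNBounded_of_pos (B : E →L[ℝ] E →L[ℝ] ℝ) (hB : ∀ v, v ≠ 0 → 0 < B v v) :
    Bornology.IsVonNBounded ℝ {v : E | B v v < 1} := by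
  rw [NormedSpace.isVonNBounded_iff]
  have hcont : Continuous fun v => B v v := B.continuous.clm_apply continuous_id
  rcases (Metric.sphere (0 : E) 1).eq_empty_or_nonempty with h | h
  · refine (Metric.isBounded_closedBall (x := (0 : E)) (r := 0)).subset fun v _ => ?_
    by_contra hv
    have hv' : v ≠ 0 := fun h0 => hv (by simp [h0])
    have : ‖v‖⁻¹ • v ∈ Metric.sphere (0 : E) 1 := by simp [norm_smul, hv']
    simp [h] at this
  · obtain ⟨z, hz, hmin⟩ := (isCompact_sphere (0 : E) 1).exists_isMinOn h hcont.continuousOn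
    have hz0 : z ≠ 0 := by
      rintro rfl
      simp at hz
    have hc := hB z hz0
    refine (Metric.isBounded_closedBall (x := (0 : E)) (r := (B z z)⁻¹ + 1)).subset fun v hv => ?_
    rw [mem_closedBall_zero_iff]
    by_cases hv0 : v = 0
    · subst hv0
      simp only [norm_zero]
      positivity
    have hn : 0 < ‖v‖ := norm_pos_iff.mpr hv0
    have hm : ‖v‖⁻¹ • v ∈ Metric.sphere (0 : E) 1 := by simp [norm_smul, hv0]
    have h1 : B z z ≤ B (‖v‖⁻¹ • v) (‖v‖⁻¹ • v) := hmin hm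
    have h2 : B (‖v‖⁻¹ • v) (‖v‖⁻¹ • v) = B v v / ‖v‖ ^ 2 := by
      simp
      field_simp
    rw [h2, le_div_iff₀ (by positivity)] at h1
    have h3 : B z z * ‖v‖ ^ 2 < 1 := lt_of_le_of_lt h1 hv
    have h4 : ‖v‖ ^ 2 < (B z z)⁻¹ := by
      rw [lt_inv_comm₀ (by positivity) hc, lt_inv_comm₀ hc (by positivity)]
      rw [inv_eq_one_div, lt_div_iff₀ hc]
      linarith
    nlinarith [sq_nonneg (‖v‖ - 1)]

/-- `e` is an orthonormal basis of the subspace `P ⊆ T_pM` for the metric `g`: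
an orthonormal family of `dim P` vectors of `P`. -/
def IsOrthonormalBasisOf (g : RiemMetric I M) (p : M) (P : Submodule ℝ (TangentSpace I p))
    (e : Fin (Module.finrank ℝ P) → TangentSpace I p) : Prop :=
  (∀ i, e i ∈ P) ∧ ∀ i j, g.inner p (e i) (e j) = if i = j then 1 else 0

theorem exists_isOrthonormalBasisOf (g : RiemMetric I M) (p : M)
    (P : Submodule ℝ (TangentSpace I p)) : ∃ e, IsOrthonormalBasisOf g p P e := by
  let c : InnerProductSpace.Core ℝ P :=
    { inner := fun u v => g.inner p u v
      conj_inner_symm := fun u v => g.symm p _ _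
      re_inner_nonneg := fun u => by
        by_cases h : (u : TangentSpace I p) = 0
        · simp [h]
        · exact (g.pos p u h).le
      add_left := fun u v w => by simp
      smul_left := fun u v r => by simp
      definite := fun u hu => by
        by_contra h
        have h' : (u : TangentSpace I p) ≠ 0 := fun h0 => h (Subtype.ext h0)
        exact (g.pos p u h').ne' hu }
  let _ : NormedAddCommGroup P := c.toNormedAddCommGroup
  let _ : InnerProductSpace ℝ P := InnerProductSpace.ofCore c.toCore
  have _ : FiniteDimensional ℝ (TangentSpace I p) := inferInstanceAs (FiniteDimensional ℝ E)
  let b := stdOrthonormalBasis ℝ P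
  refine ⟨fun i => b i, fun i => (b i).2, fun i j => ?_⟩
  exact (orthonormal_iff_ite.mp b.orthonormal) i j

/-- An orthonormal basis `e_1, …, e_k` of a `k`-dimensional subspace `P` of `T_pM`. The quantities
defined below through it (traces) do not depend on which one is chosen. -/
def orthonormalFrame (g : RiemMetric I M) (p : M) (P : Submodule ℝ (TangentSpace I p)) :
    Fin (Module.finrank ℝ P) → TangentSpace I p :=
  (exists_isOrthonormalBasisOf g p P).choose

end Frames

/-! ### Levi-Civita connection and curvature -/

/-! The manifolds considered here have no boundary (the model is `𝓘(ℝ, E)`, or a product of two such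
models). All quantities at `p` are tensorial, hence may be computed in the preferred chart at `p`. -/

section LeviCivita

/-- The Christoffel symbols `Γ_y(u, v)` of a Riemannian metric `G` on an open subset of `E`, that
is, `∇_u v` at `y` for the constant vector fields `u`, `v`. They are given by the Koszul formula
`2 G_y(Γ_y(u, v), w) = DG_y(u)(v, w) + DG_y(v)(u, w) - DG_y(w)(u, v)`. -/
def christoffel {E : Type*} [NormedAddCommGroup E] [NormedSpace ℝ E]
    (G : E → E →L[ℝ] E →L[ℝ] ℝ) (y u v : E) : E :=
  (G y).inverse ((1 / 2 : ℝ) • (fderiv ℝ G y u v + fderiv ℝ G y v u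
    - ((fderiv ℝ G y).flip u).flip v))

variable {E : Type*} [NormedAddCommGroup E] [NormedSpace ℝ E]
  {H : Type*} [TopologicalSpace H] {I : ModelWithCorners ℝ E H}
  {M : Type*} [TopologicalSpace M] [ChartedSpace H M] [IsManifold I ∞ M]

/-- The metric `g` read in the chart `φ` at `p`, i.e. the pullback of `g` under `φ⁻¹`. -/
def metricInChart (g : RiemMetric I M) (p : M) (y : E) : E →L[ℝ] E →L[ℝ] ℝ :=
  let A : E →L[ℝ] TangentSpace I ((extChartAt I p).symm y) :=
    mfderiv 𝓘(ℝ, E) I (extChartAt I p).symm y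
  pullbackForm (g.inner ((extChartAt I p).symm y)) A

/-- The Christoffel symbols of `g` in the chart at `p`, at the point `p`. Mathlib identifies `T_pM`
with `E` through that chart. -/
def christoffelAt (g : RiemMetric I M) (p : M) (u v : TangentSpace I p) : TangentSpace I p :=
  let w : E := christoffel (metricInChart g p) (extChartAt I p p) u v
  w

/-- The Riemann curvature `R(u, v) w = ∇_u ∇_v w - ∇_v ∇_u w - ∇_[u,v] w` at `p`, computed in the
chart at `p` with the coordinate-constant extensions of `u`, `v`, `w`. -/
def riemannCurvature (g : RiemMetric I M) (p : M) (u v w : TangentSpace I p) :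
    TangentSpace I p :=
  let Γ : E → E → E → E := christoffel (metricInChart g p)
  let y : E := extChartAt I p p
  let R : E := (fderiv ℝ (fun z => Γ z v w) y u + Γ y u (Γ y v w))
    - (fderiv ℝ (fun z => Γ z u w) y v + Γ y v (Γ y u w))
  R

/-- The sectional curvature `K(u ∧ v)` of the plane spanned by `u`, `v`. -/
def sectionalCurvature (g : RiemMetric I M) (p : M) (u v : TangentSpace I p) : ℝ :=
  g.inner p (riemannCurvature g p u v v) u
    / (g.inner p u u * g.inner p v v - g.inner p u v ^ 2)

/-- The scalar curvature `τ(P) = ∑_{i < j} K(e_i ∧ e_j)` of a subspace `P` of `T_pM`, where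
`e_1, …, e_k` is an orthonormal basis of `P`. -/
def scalarCurvature [FiniteDimensional ℝ E] (g : RiemMetric I M) (p : M)
    (P : Submodule ℝ (TangentSpace I p)) : ℝ :=
  ∑ i, ∑ j ∈ Finset.Ioi i,
    sectionalCurvature g p (orthonormalFrame g p P i) (orthonormalFrame g p P j)

/-- The Hessian `H^ψ(u, v) = u v ψ - (∇_u v) ψ` at `p`, computed in the chart at `p` with the
coordinate-constant extensions of `u` and `v`. -/
def hessian (g : RiemMetric I M) (ψ : M → ℝ) (p : M) (u v : TangentSpace I p) : ℝ :=
  let f : E → ℝ := ψ ∘ (extChartAt I p).symm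
  let y : E := extChartAt I p p
  fderiv ℝ (fun z => fderiv ℝ f z v) y u - fderiv ℝ f y (christoffelAt g p u v)

/-- The Laplacian with the sign convention `Δψ = -trace H^ψ`. -/
def laplacian [FiniteDimensional ℝ E] (g : RiemMetric I M) (ψ : M → ℝ) (p : M) : ℝ :=
  -∑ i, hessian g ψ p (orthonormalFrame g p ⊤ i) (orthonormalFrame g p ⊤ i)

end LeviCivita

/-! ### Isometric immersions -/

section Immersions

variable {E : Type*} [NormedAddCommGroup E] [NormedSpace ℝ E]
  {H : Type*} [TopologicalSpace H] {I : ModelWithCorners ℝ E H}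
  {M : Type*} [TopologicalSpace M] [ChartedSpace H M] [IsManifold I ∞ M]
  {F : Type*} [NormedAddCommGroup F] [NormedSpace ℝ F]
  {K : Type*} [TopologicalSpace K] {J : ModelWithCorners ℝ F K}
  {N : Type*} [TopologicalSpace N] [ChartedSpace K N] [IsManifold J ∞ N]

/-- `x : (M, g) → (N, h)` is an isometric immersion: it is smooth and `x^* h = g`. (That each
`dx_p` is injective follows, since `g` is positive definite.) -/
structure IsIsometricImmersion (g : RiemMetric I M) (h : RiemMetric J N) (x : M → N) : Prop where
  contMDiff : ContMDiff I J ∞ x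
  isometric : ∀ (p : M) (u v : TangentSpace I p),
    h.inner (x p) (mfderiv I J x p u) (mfderiv I J x p v) = g.inner p u v

/-- The second fundamental form `σ(u, v) = ∇̃_u (dx v) - dx (∇_u v)` of `x : (M, g) → (N, h)` at
`p`, computed in the charts at `p` and `x p` with the coordinate-constant extension of `v`. -/
def secondFundamentalForm (g : RiemMetric I M) (h : RiemMetric J N) (x : M → N) (p : M)
    (u v : TangentSpace I p) : TangentSpace J (x p) :=
  let f : E → F := writtenInExtChartAt I J p x
  let y : E := extChartAt I p p
  let D : TangentSpace J (x p) := fderiv ℝ (fun z => fderiv ℝ f z v) y u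
  D + christoffelAt h (x p) (mfderiv I J x p u) (mfderiv I J x p v)
    - mfderiv I J x p (christoffelAt g p u v)

/-- The image `dx(P)` in `T_{x(p)} N` of a subspace `P` of `T_pM`. -/
def tangentImage (I : ModelWithCorners ℝ E H) (J : ModelWithCorners ℝ F K) (x : M → N) (p : M)
    (P : Submodule ℝ (TangentSpace I p)) : Submodule ℝ (TangentSpace J (x p)) :=
  P.map (mfderiv I J x p).toLinearMap

/-- The mean curvature vector `(1 / k) ∑ σ(e_i, e_i)` of `x` relative to a `k`-dimensional subspace
`P` of `T_pM` with orthonormal basis `e_1, …, e_k`. -/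
def partialMeanCurvature [FiniteDimensional ℝ E] (g : RiemMetric I M) (h : RiemMetric J N)
    (x : M → N) (p : M) (P : Submodule ℝ (TangentSpace I p)) : TangentSpace J (x p) :=
  (1 / (Module.finrank ℝ P : ℝ)) •
    ∑ i, secondFundamentalForm g h x p (orthonormalFrame g p P i) (orthonormalFrame g p P i)

/-- The mean curvature vector `H = (1 / n) trace σ`. -/
def meanCurvature [FiniteDimensional ℝ E] (g : RiemMetric I M) (h : RiemMetric J N)
    (x : M → N) (p : M) : TangentSpace J (x p) :=
  partialMeanCurvature g h x p ⊤

/-- Smoothness of the pullback of a metric under a smooth map. -/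
theorem contMDiff_pullback (h : RiemMetric J N) {f : M → N} (hf : ContMDiff I J ∞ f) :
    ContMDiff I (I.prod 𝓘(ℝ, E →L[ℝ] E →L[ℝ] ℝ)) ∞
      (fun p => TotalSpace.mk' (E →L[ℝ] E →L[ℝ] ℝ)
        (E := fun p : M => TangentSpace I p →L[ℝ] TangentSpace I p →L[ℝ] ℝ) p
        (pullbackForm (h.inner (f p)) (mfderiv I J f p))) := by
  intro p₀
  have hg : ContMDiffAt I 𝓘(ℝ, F →L[ℝ] F →L[ℝ] ℝ) ∞ (fun p =>
      ContinuousLinearMap.inCoordinates F (fun q : N => TangentSpace J q) (F →L[ℝ] ℝ)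
        (fun q : N => TangentSpace J q →L[ℝ] ℝ) (f p₀) (f p) (f p₀) (f p) (h.inner (f p))) p₀ :=
    ((contMDiffAt_hom_bundle _).mp (h.contMDiff (f p₀))).2.comp p₀ (hf p₀)
  have hd := (hf p₀).mfderiv_const (m := ∞) le_rfl
  rw [contMDiffAt_hom_bundle]
  refine ⟨contMDiffAt_id, ?_⟩
  refine ((hd.clm_precomp (F₃ := ℝ)).clm_comp (hg.clm_comp hd)).congr_of_eventuallyEq ?_
  have hb : ∀ᶠ p in 𝓝 p₀, p ∈ (trivializationAt E (TangentSpace I) p₀).baseSet :=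
    (trivializationAt E (TangentSpace I) p₀).open_baseSet.mem_nhds
      (FiberBundle.mem_baseSet_trivializationAt' p₀)
  have hb' : ∀ᶠ p in 𝓝 p₀, f p ∈ (trivializationAt F (TangentSpace J) (f p₀)).baseSet :=
    (hf p₀).continuousAt.eventually
      ((trivializationAt F (TangentSpace J) (f p₀)).open_baseSet.mem_nhds
        (FiberBundle.mem_baseSet_trivializationAt' (f p₀)))
  filter_upwards [hb, hb'] with p hp hp'
  ext u v
  change ContinuousLinearMap.inCoordinates E (TangentSpace I) (E →L[ℝ] ℝ)
      (fun b ↦ TangentSpace I b →L[ℝ] ℝ) p₀ p p₀ p _ u v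
    = ContinuousLinearMap.inCoordinates F (TangentSpace J) (F →L[ℝ] ℝ)
      (fun b ↦ TangentSpace J b →L[ℝ] ℝ) (f p₀) (f p) (f p₀) (f p) (h.inner (f p))
      (inTangentCoordinates I J id f (fun p => mfderiv I J f p) p₀ p u)
      (inTangentCoordinates I J id f (fun p => mfderiv I J f p) p₀ p v)
  rw [inCoordinates_apply_eq₂ (F₃ := ℝ) (E₃ := fun _ => ℝ) hp hp (by simp),
    inCoordinates_apply_eq₂ (F₃ := ℝ) (E₃ := fun _ => ℝ) hp' hp' (by simp)]
  simp only [inTangentCoordinates, id]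
  rw [ContinuousLinearMap.inCoordinates_eq hp hp']
  have hs (w : TangentSpace J (f p)) :
      (trivializationAt F (TangentSpace J) (f p₀)).symm (f p)
        ((trivializationAt F (TangentSpace J) (f p₀)) ⟨f p, w⟩).2 = w :=
    Trivialization.symm_apply_apply_mk _ hp' w
  simp [hs]

end Immersions

/-! ### Doubly warped products -/

section DoublyWarped

/-- A positive smooth function. -/
structure WarpingFunction {E : Type*} [NormedAddCommGroup E] [NormedSpace ℝ E]
    {H : Type*} [TopologicalSpace H] (I : ModelWithCorners ℝ E H)
    (M : Type*) [TopologicalSpace M] [ChartedSpace H M] where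
  /-- The underlying function. -/
  toFun : M → ℝ
  contMDiff : ContMDiff I 𝓘(ℝ, ℝ) ∞ toFun
  pos : ∀ p, 0 < toFun p

instance {E : Type*} [NormedAddCommGroup E] [NormedSpace ℝ E]
    {H : Type*} [TopologicalSpace H] (I : ModelWithCorners ℝ E H)
    (M : Type*) [TopologicalSpace M] [ChartedSpace H M] :
    CoeFun (WarpingFunction I M) fun _ => M → ℝ := ⟨WarpingFunction.toFun⟩

variable {E₁ : Type*} [NormedAddCommGroup E₁] [NormedSpace ℝ E₁]
  {H₁ : Type*} [TopologicalSpace H₁] {I₁ : ModelWithCorners ℝ E₁ H₁}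
  {M₁ : Type*} [TopologicalSpace M₁] [ChartedSpace H₁ M₁] [IsManifold I₁ ∞ M₁]
  {E₂ : Type*} [NormedAddCommGroup E₂] [NormedSpace ℝ E₂]
  {H₂ : Type*} [TopologicalSpace H₂] {I₂ : ModelWithCorners ℝ E₂ H₂}
  {M₂ : Type*} [TopologicalSpace M₂] [ChartedSpace H₂ M₂] [IsManifold I₂ ∞ M₂]

set_option synthInstance.maxHeartbeats 400000 in
theorem contMDiff_form_add {G G' : ∀ p : M₁, TangentSpace I₁ p →L[ℝ] TangentSpace I₁ p →L[ℝ] ℝ}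
    (h : ContMDiff I₁ (I₁.prod 𝓘(ℝ, E₁ →L[ℝ] E₁ →L[ℝ] ℝ)) ∞
      (fun p => TotalSpace.mk' (E₁ →L[ℝ] E₁ →L[ℝ] ℝ)
        (E := fun p : M₁ => TangentSpace I₁ p →L[ℝ] TangentSpace I₁ p →L[ℝ] ℝ) p (G p)))
    (h' : ContMDiff I₁ (I₁.prod 𝓘(ℝ, E₁ →L[ℝ] E₁ →L[ℝ] ℝ)) ∞
      (fun p => TotalSpace.mk' (E₁ →L[ℝ] E₁ →L[ℝ] ℝ)
        (E := fun p : M₁ => TangentSpace I₁ p →L[ℝ] TangentSpace I₁ p →L[ℝ] ℝ) p (G' p))) :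
    ContMDiff I₁ (I₁.prod 𝓘(ℝ, E₁ →L[ℝ] E₁ →L[ℝ] ℝ)) ∞
      (fun p => TotalSpace.mk' (E₁ →L[ℝ] E₁ →L[ℝ] ℝ)
        (E := fun p : M₁ => TangentSpace I₁ p →L[ℝ] TangentSpace I₁ p →L[ℝ] ℝ) p (G p + G' p)) :=
  ContMDiff.add_section h h'

set_option synthInstance.maxHeartbeats 400000 in
theorem contMDiff_form_smul {G : ∀ p : M₁, TangentSpace I₁ p →L[ℝ] TangentSpace I₁ p →L[ℝ] ℝ}
    {f : M₁ → ℝ} (hf : ContMDiff I₁ 𝓘(ℝ, ℝ) ∞ f)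
    (h : ContMDiff I₁ (I₁.prod 𝓘(ℝ, E₁ →L[ℝ] E₁ →L[ℝ] ℝ)) ∞
      (fun p => TotalSpace.mk' (E₁ →L[ℝ] E₁ →L[ℝ] ℝ)
        (E := fun p : M₁ => TangentSpace I₁ p →L[ℝ] TangentSpace I₁ p →L[ℝ] ℝ) p (G p))) :
    ContMDiff I₁ (I₁.prod 𝓘(ℝ, E₁ →L[ℝ] E₁ →L[ℝ] ℝ)) ∞
      (fun p => TotalSpace.mk' (E₁ →L[ℝ] E₁ →L[ℝ] ℝ)
        (E := fun p : M₁ => TangentSpace I₁ p →L[ℝ] TangentSpace I₁ p →L[ℝ] ℝ) p (f p • G p)) :=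
  ContMDiff.smul_section hf h

/-- The metric `c² g` on `M`, for a constant `c > 0`. -/
def scaledMetric [FiniteDimensional ℝ E₁] (g : RiemMetric I₁ M₁) (c : ℝ) (hc : 0 < c) :
    RiemMetric I₁ M₁ where
  inner p := c ^ 2 • g.inner p
  symm p u v := by
    change c ^ 2 * g.inner p u v = c ^ 2 * g.inner p v u
    rw [g.symm p u v]
  pos p v hv := mul_pos (pow_pos hc 2) (g.pos p v hv)
  isVonNBounded p :=
    isVonNBounded_of_pos (E := E₁) (c ^ 2 • g.inner p)
      fun v hv => mul_pos (pow_pos hc 2) (g.pos p v hv)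
  contMDiff := contMDiff_form_smul contMDiff_const g.contMDiff

/-- The scalar product `ρ₂(π₂ p)² π₁^* g₁ + ρ₁(π₁ p)² π₂^* g₂` on `T_p(M₁ × M₂)`. -/
def doublyWarpedForm (g₁ : RiemMetric I₁ M₁) (g₂ : RiemMetric I₂ M₂)
    (ρ₁ : WarpingFunction I₁ M₁) (ρ₂ : WarpingFunction I₂ M₂) (p : M₁ × M₂) :
    TangentSpace (I₁.prod I₂) p →L[ℝ] TangentSpace (I₁.prod I₂) p →L[ℝ] ℝ :=
  ρ₂ p.2 ^ 2 • pullbackForm (g₁.inner p.1) (mfderiv (I₁.prod I₂) I₁ Prod.fst p)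
    + ρ₁ p.1 ^ 2 • pullbackForm (g₂.inner p.2) (mfderiv (I₁.prod I₂) I₂ Prod.snd p)

theorem doublyWarpedForm_apply (g₁ : RiemMetric I₁ M₁) (g₂ : RiemMetric I₂ M₂)
    (ρ₁ : WarpingFunction I₁ M₁) (ρ₂ : WarpingFunction I₂ M₂) (p : M₁ × M₂) (u v : E₁ × E₂) :
    doublyWarpedForm g₁ g₂ ρ₁ ρ₂ p u v =
      ρ₂ p.2 ^ 2 * g₁.inner p.1 u.1 v.1 + ρ₁ p.1 ^ 2 * g₂.inner p.2 u.2 v.2 := by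
  unfold doublyWarpedForm
  rw [mfderiv_fst, mfderiv_snd]
  rfl

theorem doublyWarpedForm_pos (g₁ : RiemMetric I₁ M₁) (g₂ : RiemMetric I₂ M₂)
    (ρ₁ : WarpingFunction I₁ M₁) (ρ₂ : WarpingFunction I₂ M₂) (p : M₁ × M₂) (v : E₁ × E₂)
    (hv : v ≠ 0) : 0 < doublyWarpedForm g₁ g₂ ρ₁ ρ₂ p v v := by
  rw [doublyWarpedForm_apply]
  have a₁ : 0 < ρ₂ p.2 ^ 2 := pow_pos (ρ₂.pos _) 2
  have a₂ : 0 < ρ₁ p.1 ^ 2 := pow_pos (ρ₁.pos _) 2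
  by_cases h₁ : v.1 = 0
  · have h₂ : v.2 ≠ 0 := fun h₂ => hv (Prod.ext h₁ h₂)
    have b₂ : 0 < g₂.inner p.2 v.2 v.2 := g₂.pos p.2 v.2 h₂
    have b₁ : g₁.inner p.1 v.1 v.1 = 0 := by
      rw [h₁]
      exact map_zero (g₁.inner p.1 (0 : E₁))
    rw [b₁]
    linarith [mul_pos a₂ b₂]
  · have b₁ : 0 < g₁.inner p.1 v.1 v.1 := g₁.pos p.1 v.1 h₁
    have b₂ : 0 ≤ g₂.inner p.2 v.2 v.2 := by
      by_cases h₂ : v.2 = 0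
      · rw [h₂]
        exact (map_zero (g₂.inner p.2 (0 : E₂))).ge
      · exact (g₂.pos p.2 v.2 h₂).le
    linarith [mul_pos a₁ b₁, mul_nonneg a₂.le b₂]

/-- The doubly warped product metric
`g = (ρ₂ ∘ π₂)² π₁^* g₁ + (ρ₁ ∘ π₁)² π₂^* g₂` on `M₁ × M₂`. -/
def doublyWarpedMetric [FiniteDimensional ℝ E₁] [FiniteDimensional ℝ E₂]
    (g₁ : RiemMetric I₁ M₁) (g₂ : RiemMetric I₂ M₂)
    (ρ₁ : WarpingFunction I₁ M₁) (ρ₂ : WarpingFunction I₂ M₂) :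
    RiemMetric (I₁.prod I₂) (M₁ × M₂) where
  inner := doublyWarpedForm g₁ g₂ ρ₁ ρ₂
  symm p u v := by
    have h₁ := g₁.symm p.1 (Prod.fst (show E₁ × E₂ from u)) (Prod.fst (show E₁ × E₂ from v))
    have h₂ := g₂.symm p.2 (Prod.snd (show E₁ × E₂ from u)) (Prod.snd (show E₁ × E₂ from v))
    refine (doublyWarpedForm_apply g₁ g₂ ρ₁ ρ₂ p u v).trans
      (Eq.trans ?_ (doublyWarpedForm_apply g₁ g₂ ρ₁ ρ₂ p v u).symm)
    exact congrArg₂ (fun a b => ρ₂ p.2 ^ 2 * a + ρ₁ p.1 ^ 2 * b) h₁ h₂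
  pos p v hv := doublyWarpedForm_pos g₁ g₂ ρ₁ ρ₂ p v hv
  isVonNBounded p := isVonNBounded_of_pos (E := E₁ × E₂) (doublyWarpedForm g₁ g₂ ρ₁ ρ₂ p)
    (doublyWarpedForm_pos g₁ g₂ ρ₁ ρ₂ p)
  contMDiff := contMDiff_form_add
    (contMDiff_form_smul ((ρ₂.contMDiff.comp contMDiff_snd).pow 2)
      (contMDiff_pullback g₁ contMDiff_fst))
    (contMDiff_form_smul ((ρ₁.contMDiff.comp contMDiff_fst).pow 2)
      (contMDiff_pullback g₂ contMDiff_snd))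

/-- The metric induced on the leaf `M₁ × {b}` is `ρ₂(b)² g₁`. -/
theorem isIsometricImmersion_leaf₁ [FiniteDimensional ℝ E₁] [FiniteDimensional ℝ E₂]
    (g₁ : RiemMetric I₁ M₁) (g₂ : RiemMetric I₂ M₂)
    (ρ₁ : WarpingFunction I₁ M₁) (ρ₂ : WarpingFunction I₂ M₂) (b : M₂) :
    IsIsometricImmersion (scaledMetric g₁ (ρ₂ b) (ρ₂.pos b)) (doublyWarpedMetric g₁ g₂ ρ₁ ρ₂)
      (fun a => (a, b)) where
  contMDiff := contMDiff_id.prodMk contMDiff_const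
  isometric a u v := by
    rw [mfderiv_prod_left]
    refine (doublyWarpedForm_apply g₁ g₂ ρ₁ ρ₂ (a, b) ((u, 0) : E₁ × E₂) ((v, 0) : E₁ × E₂)).trans
      ?_
    have h0 : g₂.inner b (0 : E₂) (0 : E₂) = 0 := map_zero (g₂.inner b (0 : E₂))
    change ρ₂ b ^ 2 * g₁.inner a u v + ρ₁ a ^ 2 * g₂.inner b (0 : E₂) (0 : E₂) = _
    rw [h0, mul_zero, add_zero]
    rfl

/-- The metric induced on the leaf `{a} × M₂` is `ρ₁(a)² g₂`. -/
theorem isIsometricImmersion_leaf₂ [FiniteDimensional ℝ E₁] [FiniteDimensional ℝ E₂]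
    (g₁ : RiemMetric I₁ M₁) (g₂ : RiemMetric I₂ M₂)
    (ρ₁ : WarpingFunction I₁ M₁) (ρ₂ : WarpingFunction I₂ M₂) (a : M₁) :
    IsIsometricImmersion (scaledMetric g₂ (ρ₁ a) (ρ₁.pos a)) (doublyWarpedMetric g₁ g₂ ρ₁ ρ₂)
      (fun b => (a, b)) where
  contMDiff := contMDiff_const.prodMk contMDiff_id
  isometric b u v := by
    rw [mfderiv_prod_right]
    refine (doublyWarpedForm_apply g₁ g₂ ρ₁ ρ₂ (a, b) ((0, u) : E₁ × E₂) ((0, v) : E₁ × E₂)).trans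
      ?_
    have h0 : g₁.inner a (0 : E₁) (0 : E₁) = 0 := map_zero (g₁.inner a (0 : E₁))
    change ρ₂ b ^ 2 * g₁.inner a (0 : E₁) (0 : E₁) + ρ₁ a ^ 2 * g₂.inner b u v = _
    rw [h0, mul_zero, zero_add]
    rfl

/-- The distribution `𝒟₁ = T M₁ = ker dπ₂` of vectors tangent to the leaves `M₁ × {p₂}`. -/
def leafTangent₁ (I₁ : ModelWithCorners ℝ E₁ H₁) (I₂ : ModelWithCorners ℝ E₂ H₂) (p : M₁ × M₂) :
    Submodule ℝ (TangentSpace (I₁.prod I₂) p) :=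
  LinearMap.ker (mfderiv (I₁.prod I₂) I₂ Prod.snd p).toLinearMap

/-- The distribution `𝒟₂ = T M₂ = ker dπ₁` of vectors tangent to the leaves `{p₁} × M₂`. -/
def leafTangent₂ (I₁ : ModelWithCorners ℝ E₁ H₁) (I₂ : ModelWithCorners ℝ E₂ H₂) (p : M₁ × M₂) :
    Submodule ℝ (TangentSpace (I₁.prod I₂) p) :=
  LinearMap.ker (mfderiv (I₁.prod I₂) I₁ Prod.fst p).toLinearMap

/-- At `p = (p₁, p₂)`: `Δ₁ρ₁`, where `Δ₁` is the Laplacian of the leaf `M₁ × {p₂}` through `p`, i.e.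
of `M₁` with the metric `ρ₂(p₂)² g₁` that the doubly warped product induces on that leaf. -/
def leafLaplacian₁ [FiniteDimensional ℝ E₁] (g₁ : RiemMetric I₁ M₁) (ρ₁ : WarpingFunction I₁ M₁)
    (ρ₂ : WarpingFunction I₂ M₂) (p : M₁ × M₂) : ℝ :=
  laplacian (scaledMetric g₁ (ρ₂ p.2) (ρ₂.pos p.2)) ρ₁ p.1

/-- At `p = (p₁, p₂)`: `Δ₂ρ₂`, where `Δ₂` is the Laplacian of the leaf `{p₁} × M₂` through `p`, i.e.
of `M₂` with the metric `ρ₁(p₁)² g₂` that the doubly warped product induces on that leaf. -/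
def leafLaplacian₂ [FiniteDimensional ℝ E₂] (g₂ : RiemMetric I₂ M₂) (ρ₁ : WarpingFunction I₁ M₁)
    (ρ₂ : WarpingFunction I₂ M₂) (p : M₁ × M₂) : ℝ :=
  laplacian (scaledMetric g₂ (ρ₁ p.1) (ρ₁.pos p.1)) ρ₂ p.2

variable {F : Type*} [NormedAddCommGroup F] [NormedSpace ℝ F]
  {K : Type*} [TopologicalSpace K] {J : ModelWithCorners ℝ F K}
  {N : Type*} [TopologicalSpace N] [ChartedSpace K N] [IsManifold J ∞ N]

/-- `x` is mixed totally geodesic: `σ(X, Z) = 0` for `X ∈ 𝒟₁` and `Z ∈ 𝒟₂`. -/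
def IsMixedTotallyGeodesic (g : RiemMetric (I₁.prod I₂) (M₁ × M₂)) (h : RiemMetric J N)
    (x : M₁ × M₂ → N) : Prop :=
  ∀ p, ∀ X ∈ leafTangent₁ I₁ I₂ p, ∀ Z ∈ leafTangent₂ I₁ I₂ p,
    secondFundamentalForm g h x p X Z = 0

/-- `n₂ Δ₁ρ₁ / ρ₁ + n₁ Δ₂ρ₂ / ρ₂` at `p = (p₁, p₂)`, where `nᵢ = dim Mᵢ`. -/
def warpingTerm [FiniteDimensional ℝ E₁] [FiniteDimensional ℝ E₂]
    (g₁ : RiemMetric I₁ M₁) (g₂ : RiemMetric I₂ M₂)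
    (ρ₁ : WarpingFunction I₁ M₁) (ρ₂ : WarpingFunction I₂ M₂) (p : M₁ × M₂) : ℝ :=
  (Module.finrank ℝ E₂ : ℝ) * (leafLaplacian₁ g₁ ρ₁ ρ₂ p / ρ₁ p.1)
    + (Module.finrank ℝ E₁ : ℝ) * (leafLaplacian₂ g₂ ρ₁ ρ₂ p / ρ₂ p.2)

/-- `(n² / 4) ‖H‖² + τ̃(T_pM) - τ̃(T_pM₁) - τ̃(T_pM₂)` at `p`, where `n = n₁ + n₂ = dim M`, the norm
and the scalar curvature `τ̃` are those of the ambient metric `h`, and the subspaces of `T_pM` are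
regarded as subspaces of `T_{x(p)} N` through `dx`. -/
def extrinsicTerm [FiniteDimensional ℝ E₁] [FiniteDimensional ℝ E₂] [FiniteDimensional ℝ F]
    (g : RiemMetric (I₁.prod I₂) (M₁ × M₂)) (h : RiemMetric J N) (x : M₁ × M₂ → N)
    (p : M₁ × M₂) : ℝ :=
  ((Module.finrank ℝ E₁ : ℝ) + Module.finrank ℝ E₂) ^ 2 / 4
      * h.inner (x p) (meanCurvature g h x p) (meanCurvature g h x p)
    + scalarCurvature h (x p) (tangentImage (I₁.prod I₂) J x p ⊤)
    - scalarCurvature h (x p) (tangentImage (I₁.prod I₂) J x p (leafTangent₁ I₁ I₂ p))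
    - scalarCurvature h (x p) (tangentImage (I₁.prod I₂) J x p (leafTangent₂ I₁ I₂ p))

/-- `n₁ H₁ = n₂ H₂` everywhere, where `Hᵢ` is the partial mean curvature vector of `x` relative to
the distribution `𝒟ᵢ = T Mᵢ`. -/
def HasEqualPartialMeanCurvatures [FiniteDimensional ℝ E₁] [FiniteDimensional ℝ E₂]
    (g : RiemMetric (I₁.prod I₂) (M₁ × M₂)) (h : RiemMetric J N) (x : M₁ × M₂ → N) : Prop :=
  ∀ p, (Module.finrank ℝ E₁ : ℝ) • partialMeanCurvature g h x p (leafTangent₁ I₁ I₂ p)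
    = (Module.finrank ℝ E₂ : ℝ) • partialMeanCurvature g h x p (leafTangent₂ I₁ I₂ p)

end DoublyWarped

end

set_option maxSynthPendingDepth 3

noncomputable section

section LocalMetrics

variable {E : Type*} [NormedAddCommGroup E] [NormedSpace ℝ E]

/-- `G` is a Riemannian metric of class `C²` on a neighbourhood of `y`. -/
structure IsMetricNear (G : E → E →L[ℝ] E →L[ℝ] ℝ) (y : E) : Prop where
  contDiffAt : ContDiffAt ℝ 2 G y
  symm : ∀ᶠ z in 𝓝 y, ∀ u v, G z u v = G z v u
  pos : ∀ᶠ z in 𝓝 y, ∀ v, v ≠ 0 → 0 < G z v v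

/-- The Christoffel symbols of the first kind. -/
def christoffelLow (G : E → E →L[ℝ] E →L[ℝ] ℝ) (y u v w : E) : ℝ :=
  1 / 2 * (fderiv ℝ G y u v w + fderiv ℝ G y v u w - fderiv ℝ G y w u v)

/-- The curvature of `G` computed from its Christoffel symbols. -/
def chartCurvature (G : E → E →L[ℝ] E →L[ℝ] ℝ) (y u v w : E) : E :=
  (fderiv ℝ (fun z => christoffel G z v w) y u + christoffel G y u (christoffel G y v w))
    - (fderiv ℝ (fun z => christoffel G z u w) y v + christoffel G y v (christoffel G y u w))

/-- The part of the curvature tensor which involves second derivatives of the metric. -/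
def secondOrderPart (G : E → E →L[ℝ] E →L[ℝ] ℝ) (y u v w t : E) : ℝ :=
  let D := fderiv ℝ (fderiv ℝ G) y
  1 / 2 * (D u w v t - D u t v w - D v w u t + D v t u w)

theorem isInvertible_of_pos [FiniteDimensional ℝ E] {B : E →L[ℝ] E →L[ℝ] ℝ}
    (hB : ∀ v, v ≠ 0 → 0 < B v v) : B.IsInvertible := by
  have hinj : Function.Injective B := by
    rw [injective_iff_map_eq_zero]
    intro v hv
    by_contra h
    have := hB v h
    rw [hv] at this
    simp at this
  have hfin : Module.finrank ℝ E = Module.finrank ℝ (E →L[ℝ] ℝ) := by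
    rw [← (LinearMap.toContinuousLinearMap (𝕜 := ℝ) (E := E) (F' := ℝ)).finrank_eq]
    exact (Subspace.dual_finrank_eq (K := ℝ) (V := E)).symm
  exact ⟨(LinearEquiv.ofInjectiveOfFinrankEq B.toLinearMap hinj hfin).toContinuousLinearEquiv,
    by ext; rfl⟩

namespace IsMetricNear

variable {G : E → E →L[ℝ] E →L[ℝ] ℝ} {y : E}

theorem eventually (hG : IsMetricNear G y) : ∀ᶠ z in 𝓝 y, IsMetricNear G z := by
  filter_upwards [hG.contDiffAt.eventually (by simp), hG.symm.eventually_nhds,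
    hG.pos.eventually_nhds] with z h1 h2 h3
  exact ⟨h1, h2, h3⟩

theorem symm_at (hG : IsMetricNear G y) (u v : E) : G y u v = G y v u :=
  hG.symm.self_of_nhds u v

theorem pos_at (hG : IsMetricNear G y) {v : E} (hv : v ≠ 0) : 0 < G y v v :=
  hG.pos.self_of_nhds v hv

theorem differentiableAt (hG : IsMetricNear G y) : DifferentiableAt ℝ G y :=
  hG.contDiffAt.differentiableAt (by simp)

theorem differentiableAt_fderiv (hG : IsMetricNear G y) : DifferentiableAt ℝ (fderiv ℝ G) y :=
  (hG.contDiffAt.fderiv_right (m := 1) (by norm_num)).differentiableAt (by simp)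

theorem ext_left (hG : IsMetricNear G y) {a b : E} (h : ∀ w, G y a w = G y b w) : a = b := by
  by_contra hab
  have := hG.pos_at (sub_ne_zero.mpr hab)
  simp only [map_sub, sub_apply, h, sub_self, lt_irrefl] at this

theorem fderiv_symm (hG : IsMetricNear G y) (u v w : E) :
    fderiv ℝ G y u v w = fderiv ℝ G y u w v := by
  have h (a b : E) : fderiv ℝ (fun z => G z a b) y u = fderiv ℝ G y u a b := by
    have := ((hG.differentiableAt.hasFDerivAt.clm_apply
      (hasFDerivAt_const a y)).clm_apply (hasFDerivAt_const b y)).fderiv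
    rw [this]
    simp
  rw [← h, ← h]
  congr 1
  apply Filter.EventuallyEq.fderiv_eq
  filter_upwards [hG.symm] with z hz using hz v w

theorem hasFDerivAt_fderiv_apply (hG : IsMetricNear G y) (u v w : E) :
    HasFDerivAt (fun z => fderiv ℝ G z u v w)
      (((fderiv ℝ (fderiv ℝ G) y).flip u).flip v |>.flip w) y := by
  have := ((hG.differentiableAt_fderiv.hasFDerivAt.clm_apply
      (hasFDerivAt_const u y)).clm_apply (hasFDerivAt_const v y)).clm_apply (hasFDerivAt_const w y)
  exact this.congr_fderiv (by ext t; simp)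

theorem fderiv_fderiv_symm (hG : IsMetricNear G y) (u v w t : E) :
    fderiv ℝ (fderiv ℝ G) y u v w t = fderiv ℝ (fderiv ℝ G) y v u w t := by
  have := hG.contDiffAt.isSymmSndFDerivAt (by simp) u v
  rw [this]

theorem fderiv_fderiv_symm' (hG : IsMetricNear G y) (u v w t : E) :
    fderiv ℝ (fderiv ℝ G) y u v w t = fderiv ℝ (fderiv ℝ G) y u v t w := by
  have h (a b : E) := DFunLike.congr_fun (hG.hasFDerivAt_fderiv_apply v a b).fderiv u
  simp only [ContinuousLinearMap.flip_apply] at h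
  rw [← h, ← h]
  congr 1
  apply Filter.EventuallyEq.fderiv_eq
  filter_upwards [hG.eventually] with z hz using hz.fderiv_symm v w t

theorem hasFDerivAt_christoffelLow (hG : IsMetricNear G y) (v w t : E) :
    HasFDerivAt (fun z => christoffelLow G z v w t)
      ((1 / 2 : ℝ) • ((((fderiv ℝ (fderiv ℝ G) y).flip v).flip w |>.flip t)
        + (((fderiv ℝ (fderiv ℝ G) y).flip w).flip v |>.flip t)
        - (((fderiv ℝ (fderiv ℝ G) y).flip t).flip v |>.flip w))) y :=
  (((hG.hasFDerivAt_fderiv_apply v w t).add (hG.hasFDerivAt_fderiv_apply w v t)).sub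
    (hG.hasFDerivAt_fderiv_apply t v w)).const_mul _

theorem fderiv_christoffelLow_sub (hG : IsMetricNear G y) (u v w t : E) :
    fderiv ℝ (fun z => christoffelLow G z v w t) y u
      - fderiv ℝ (fun z => christoffelLow G z u w t) y v = secondOrderPart G y u v w t := by
  rw [(hG.hasFDerivAt_christoffelLow v w t).fderiv, (hG.hasFDerivAt_christoffelLow u w t).fderiv]
  simp only [smul_apply, sub_apply,
    add_apply, ContinuousLinearMap.flip_apply, smul_eq_mul, secondOrderPart]
  rw [hG.fderiv_fderiv_symm v u]
  ring

theorem christoffelLow_symm (hG : IsMetricNear G y) (u v w : E) :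
    christoffelLow G y u v w = christoffelLow G y v u w := by
  unfold christoffelLow
  rw [hG.fderiv_symm w u v]
  ring

theorem fderiv_eq (hG : IsMetricNear G y) (u v w : E) :
    fderiv ℝ G y u v w = christoffelLow G y u v w + christoffelLow G y u w v := by
  unfold christoffelLow
  rw [hG.fderiv_symm u w v]
  ring

variable [FiniteDimensional ℝ E]

theorem isInvertible (hG : IsMetricNear G y) : (G y).IsInvertible :=
  isInvertible_of_pos hG.pos.self_of_nhds

theorem apply_christoffel (hG : IsMetricNear G y) (u v w : E) :
    G y (christoffel G y u v) w = christoffelLow G y u v w := by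
  unfold christoffel
  rw [hG.isInvertible.self_apply_inverse]
  simp [christoffelLow]

theorem apply_christoffel' (hG : IsMetricNear G y) (u v w : E) :
    G y w (christoffel G y u v) = christoffelLow G y u v w := by
  rw [hG.symm_at, hG.apply_christoffel]

theorem christoffel_symm (hG : IsMetricNear G y) (u v : E) :
    christoffel G y u v = christoffel G y v u :=
  hG.ext_left fun w => by
    rw [hG.apply_christoffel, hG.apply_christoffel, hG.christoffelLow_symm]

theorem differentiableAt_christoffel (hG : IsMetricNear G y) (u v : E) :
    DifferentiableAt ℝ (fun z => christoffel G z u v) y := by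
  have hinv : DifferentiableAt ℝ (fun z => (G z).inverse) y :=
    ((hG.isInvertible.contDiffAt_map_inverse (n := 1)).differentiableAt (by simp)).comp y
      hG.differentiableAt
  have hD := hG.differentiableAt_fderiv
  have h1 := (hD.clm_apply (differentiableAt_const u)).clm_apply (differentiableAt_const v)
  have h2 := (hD.clm_apply (differentiableAt_const v)).clm_apply (differentiableAt_const u)
  have h3 : DifferentiableAt ℝ (fun z => ((fderiv ℝ G z).flip u).flip v) y := by
    have e (z : E) : ((fderiv ℝ G z).flip u).flip v =
      ((ContinuousLinearMap.flipₗᵢ ℝ E E ℝ).toContinuousLinearEquiv.toContinuousLinearMap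
        (((ContinuousLinearMap.flipₗᵢ ℝ E E (E →L[ℝ] ℝ)).toContinuousLinearEquiv.toContinuousLinearMap
          (fderiv ℝ G z)) u)) v := rfl
    simp only [e]
    fun_prop
  exact hinv.clm_apply (((h1.add h2).sub h3).const_smul (1 / 2 : ℝ))

theorem apply_fderiv_christoffel (hG : IsMetricNear G y) (u v w t : E) :
    G y (fderiv ℝ (fun z => christoffel G z v w) y u + christoffel G y u (christoffel G y v w)) t
      = fderiv ℝ (fun z => christoffelLow G z v w t) y u
        - G y (christoffel G y u t) (christoffel G y v w) := by
  have h1 := (hG.differentiableAt.hasFDerivAt.clm_apply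
    (hG.differentiableAt_christoffel v w).hasFDerivAt).clm_apply (hasFDerivAt_const t y)
  have h2 : (fun z => G z (christoffel G z v w) t) =ᶠ[𝓝 y] fun z => christoffelLow G z v w t := by
    filter_upwards [hG.eventually] with z hz using hz.apply_christoffel v w t
  rw [← h2.fderiv_eq, h1.fderiv]
  simp only [map_add, add_apply, hG.apply_christoffel]
  simp [hG.fderiv_eq u]
  ring

theorem apply_chartCurvature (hG : IsMetricNear G y) (u v w t : E) :
    G y (chartCurvature G y u v w) t = secondOrderPart G y u v w t
      - G y (christoffel G y u t) (christoffel G y v w)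
      + G y (christoffel G y v t) (christoffel G y u w) := by
  unfold chartCurvature
  rw [map_sub, sub_apply, hG.apply_fderiv_christoffel,
    hG.apply_fderiv_christoffel, ← hG.fderiv_christoffelLow_sub]
  ring

theorem chartCurvature_antisymm (hG : IsMetricNear G y) (u v w t : E) :
    G y (chartCurvature G y u v w) t = -G y (chartCurvature G y v u w) t := by
  rw [hG.apply_chartCurvature, hG.apply_chartCurvature]
  simp only [secondOrderPart]
  ring

theorem chartCurvature_antisymm' (hG : IsMetricNear G y) (u v w t : E) :
    G y (chartCurvature G y u v w) t = -G y (chartCurvature G y u v t) w := by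
  rw [hG.apply_chartCurvature, hG.apply_chartCurvature]
  simp only [secondOrderPart]
  rw [hG.symm_at (christoffel G y u t), hG.symm_at (christoffel G y u w)]
  ring

end IsMetricNear

theorem christoffel_add_left (G : E → E →L[ℝ] E →L[ℝ] ℝ) (y u u' v : E) :
    christoffel G y (u + u') v = christoffel G y u v + christoffel G y u' v := by
  unfold christoffel
  rw [← map_add]
  congr 1
  ext w
  simp
  ring

theorem christoffel_smul_left (G : E → E →L[ℝ] E →L[ℝ] ℝ) (y u v : E) (c : ℝ) :
    christoffel G y (c • u) v = c • christoffel G y u v := by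
  unfold christoffel
  rw [← map_smul]
  congr 1
  ext w
  simp
  ring

end LocalMetrics

section LocalIsometries

variable {E : Type*} [NormedAddCommGroup E] [NormedSpace ℝ E]
  {F : Type*} [NormedAddCommGroup F] [NormedSpace ℝ F]

/-- Near `y`, the map `f` is an isometric immersion from the metric `G` to the metric `K`. -/
structure IsIsometricNear (G : E → E →L[ℝ] E →L[ℝ] ℝ) (K : F → F →L[ℝ] F →L[ℝ] ℝ) (f : E → F)
    (y : E) : Prop where
  source : IsMetricNear G y
  target : IsMetricNear K (f y)
  contDiffAt : ContDiffAt ℝ 3 f y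
  isometric : ∀ᶠ z in 𝓝 y, ∀ u v, G z u v = K (f z) (fderiv ℝ f z u) (fderiv ℝ f z v)

/-- The second fundamental form of `f` computed from the Christoffel symbols of `G` and `K`. -/
def chartSecondFundamentalForm (G : E → E →L[ℝ] E →L[ℝ] ℝ) (K : F → F →L[ℝ] F →L[ℝ] ℝ) (f : E → F)
    (y u v : E) : F :=
  fderiv ℝ (fun z => fderiv ℝ f z v) y u
    + christoffel K (f y) (fderiv ℝ f y u) (fderiv ℝ f y v) - fderiv ℝ f y (christoffel G y u v)

namespace IsIsometricNear

variable {G : E → E →L[ℝ] E →L[ℝ] ℝ} {K : F → F →L[ℝ] F →L[ℝ] ℝ} {f : E → F} {y : E}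

theorem eventually (h : IsIsometricNear G K f y) : ∀ᶠ z in 𝓝 y, IsIsometricNear G K f z := by
  filter_upwards [h.source.eventually, h.contDiffAt.continuousAt.eventually h.target.eventually,
    h.contDiffAt.eventually (by simp), h.isometric.eventually_nhds] with z h1 h2 h3 h4
  exact ⟨h1, h2, h3, h4⟩

theorem isometric_at (h : IsIsometricNear G K f y) (u v : E) :
    K (f y) (fderiv ℝ f y u) (fderiv ℝ f y v) = G y u v :=
  (h.isometric.self_of_nhds u v).symm

theorem hasFDerivAt (h : IsIsometricNear G K f y) : HasFDerivAt f (fderiv ℝ f y) y :=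
  (h.contDiffAt.differentiableAt (by simp)).hasFDerivAt

theorem contDiffAt_fderiv (h : IsIsometricNear G K f y) : ContDiffAt ℝ 2 (fderiv ℝ f) y :=
  h.contDiffAt.fderiv_right (m := 2) (by norm_num)

theorem hasFDerivAt_fderiv_apply (h : IsIsometricNear G K f y) (v : E) :
    HasFDerivAt (fun z => fderiv ℝ f z v) ((fderiv ℝ (fderiv ℝ f) y).flip v) y := by
  have := (h.contDiffAt_fderiv.differentiableAt (by simp)).hasFDerivAt.clm_apply
    (hasFDerivAt_const v y)
  exact this.congr_fderiv (by ext t; simp)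

theorem hasFDerivAt_fderiv_fderiv_apply (h : IsIsometricNear G K f y) (v w : E) :
    HasFDerivAt (fun z => fderiv ℝ (fderiv ℝ f) z v w)
      (((fderiv ℝ (fderiv ℝ (fderiv ℝ f)) y).flip v).flip w) y := by
  have h1 : DifferentiableAt ℝ (fderiv ℝ (fderiv ℝ f)) y :=
    (h.contDiffAt_fderiv.fderiv_right (m := 1) (by norm_num)).differentiableAt (by simp)
  have := (h1.hasFDerivAt.clm_apply (hasFDerivAt_const v y)).clm_apply (hasFDerivAt_const w y)
  exact this.congr_fderiv (by ext t; simp)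

theorem fderiv_fderiv_symm (h : IsIsometricNear G K f y) (u v : E) :
    fderiv ℝ (fderiv ℝ f) y u v = fderiv ℝ (fderiv ℝ f) y v u :=
  h.contDiffAt.isSymmSndFDerivAt (by simp; norm_num) u v

theorem fderiv_fderiv_fderiv_symm (h : IsIsometricNear G K f y) (u v w : E) :
    fderiv ℝ (fderiv ℝ (fderiv ℝ f)) y u v w = fderiv ℝ (fderiv ℝ (fderiv ℝ f)) y v u w := by
  rw [h.contDiffAt_fderiv.isSymmSndFDerivAt (by simp) u v]

theorem fderiv_metric (h : IsIsometricNear G K f y) (u v w : E) :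
    fderiv ℝ G y u v w = fderiv ℝ K (f y) (fderiv ℝ f y u) (fderiv ℝ f y v) (fderiv ℝ f y w)
      + K (f y) (fderiv ℝ (fderiv ℝ f) y u v) (fderiv ℝ f y w)
      + K (f y) (fderiv ℝ f y v) (fderiv ℝ (fderiv ℝ f) y u w) := by
  have h1 := (h.source.differentiableAt.hasFDerivAt.clm_apply
      (hasFDerivAt_const v y)).clm_apply (hasFDerivAt_const w y)
  have h2 := ((h.target.differentiableAt.hasFDerivAt.comp y h.hasFDerivAt).clm_apply
    (h.hasFDerivAt_fderiv_apply v)).clm_apply (h.hasFDerivAt_fderiv_apply w)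
  have h3 : (fun z => G z v w) =ᶠ[𝓝 y] fun z => K (f z) (fderiv ℝ f z v) (fderiv ℝ f z w) := by
    filter_upwards [h.isometric] with z hz using hz v w
  have := DFunLike.congr_fun (h1.unique (h2.congr_of_eventuallyEq h3)) u
  simp at this
  rw [this]
  ring

theorem christoffelLow_eq (h : IsIsometricNear G K f y) (u v w : E) :
    christoffelLow G y u v w = K (f y) (fderiv ℝ (fderiv ℝ f) y u v) (fderiv ℝ f y w)
      + christoffelLow K (f y) (fderiv ℝ f y u) (fderiv ℝ f y v) (fderiv ℝ f y w) := by
  unfold christoffelLow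
  rw [h.fderiv_metric, h.fderiv_metric, h.fderiv_metric, h.fderiv_fderiv_symm v u,
    h.fderiv_fderiv_symm w u, h.fderiv_fderiv_symm w v,
    h.target.symm_at (fderiv ℝ f y v), h.target.symm_at (fderiv ℝ f y u)]
  ring

theorem hasFDerivAt_fderiv_target_apply (h : IsIsometricNear G K f y) (u v w : E) :
    HasFDerivAt (fun z => fderiv ℝ K (f z) (fderiv ℝ f z u) (fderiv ℝ f z v) (fderiv ℝ f z w))
      ((fderiv ℝ K (f y) (fderiv ℝ f y u) (fderiv ℝ f y v)).comp
          ((fderiv ℝ (fderiv ℝ f) y).flip w)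
        + (((fderiv ℝ K (f y) (fderiv ℝ f y u)).comp ((fderiv ℝ (fderiv ℝ f) y).flip v)
          + ((fderiv ℝ K (f y)).comp ((fderiv ℝ (fderiv ℝ f) y).flip u)
            + ((fderiv ℝ (fderiv ℝ K) (f y)).comp (fderiv ℝ f y)).flip (fderiv ℝ f y u)).flip
              (fderiv ℝ f y v)).flip (fderiv ℝ f y w))) y :=
  (((h.target.differentiableAt_fderiv.hasFDerivAt.comp y h.hasFDerivAt).clm_apply
    (h.hasFDerivAt_fderiv_apply u)).clm_apply (h.hasFDerivAt_fderiv_apply v)).clm_apply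
    (h.hasFDerivAt_fderiv_apply w)

theorem fderiv_fderiv_target_apply (h : IsIsometricNear G K f y) (u v w t : E) :
    fderiv ℝ (fun z => fderiv ℝ K (f z) (fderiv ℝ f z u) (fderiv ℝ f z v) (fderiv ℝ f z w)) y t
      = fderiv ℝ K (f y) (fderiv ℝ f y u) (fderiv ℝ f y v) (fderiv ℝ (fderiv ℝ f) y t w)
        + fderiv ℝ K (f y) (fderiv ℝ f y u) (fderiv ℝ (fderiv ℝ f) y t v) (fderiv ℝ f y w)
        + fderiv ℝ K (f y) (fderiv ℝ (fderiv ℝ f) y t u) (fderiv ℝ f y v) (fderiv ℝ f y w)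
        + fderiv ℝ (fderiv ℝ K) (f y) (fderiv ℝ f y t) (fderiv ℝ f y u) (fderiv ℝ f y v)
          (fderiv ℝ f y w) := by
  rw [(h.hasFDerivAt_fderiv_target_apply u v w).fderiv]
  simp only [add_apply, ContinuousLinearMap.comp_apply, ContinuousLinearMap.flip_apply]
  ring

theorem hasFDerivAt_target_apply (h : IsIsometricNear G K f y) (v w t : E) :
    HasFDerivAt (fun z => K (f z) (fderiv ℝ (fderiv ℝ f) z v w) (fderiv ℝ f z t))
      ((K (f y) (fderiv ℝ (fderiv ℝ f) y v w)).comp ((fderiv ℝ (fderiv ℝ f) y).flip t)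
        + ((K (f y)).comp (((fderiv ℝ (fderiv ℝ (fderiv ℝ f)) y).flip v).flip w)
          + ((fderiv ℝ K (f y)).comp (fderiv ℝ f y)).flip (fderiv ℝ (fderiv ℝ f) y v w)).flip
            (fderiv ℝ f y t)) y :=
  ((h.target.differentiableAt.hasFDerivAt.comp y h.hasFDerivAt).clm_apply
    (h.hasFDerivAt_fderiv_fderiv_apply v w)).clm_apply (h.hasFDerivAt_fderiv_apply t)

theorem fderiv_christoffelLow (h : IsIsometricNear G K f y) (u v w t : E) :
    fderiv ℝ (fun z => christoffelLow G z v w t) y u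
      = K (f y) (fderiv ℝ (fderiv ℝ f) y v w) (fderiv ℝ (fderiv ℝ f) y u t)
        + K (f y) (fderiv ℝ (fderiv ℝ (fderiv ℝ f)) y u v w) (fderiv ℝ f y t)
        + fderiv ℝ K (f y) (fderiv ℝ f y u) (fderiv ℝ (fderiv ℝ f) y v w) (fderiv ℝ f y t)
        + 1 / 2 * (fderiv ℝ (fun z => fderiv ℝ K (f z)
              (fderiv ℝ f z v) (fderiv ℝ f z w) (fderiv ℝ f z t)) y u
          + fderiv ℝ (fun z => fderiv ℝ K (f z)
              (fderiv ℝ f z w) (fderiv ℝ f z v) (fderiv ℝ f z t)) y u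
          - fderiv ℝ (fun z => fderiv ℝ K (f z)
              (fderiv ℝ f z t) (fderiv ℝ f z v) (fderiv ℝ f z w)) y u) := by
  have h1 : (fun z => christoffelLow G z v w t) =ᶠ[𝓝 y] fun z =>
      K (f z) (fderiv ℝ (fderiv ℝ f) z v w) (fderiv ℝ f z t)
        + 1 / 2 * (fderiv ℝ K (f z) (fderiv ℝ f z v) (fderiv ℝ f z w) (fderiv ℝ f z t)
          + fderiv ℝ K (f z) (fderiv ℝ f z w) (fderiv ℝ f z v) (fderiv ℝ f z t)
          - fderiv ℝ K (f z) (fderiv ℝ f z t) (fderiv ℝ f z v) (fderiv ℝ f z w)) := by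
    filter_upwards [h.eventually] with z hz using hz.christoffelLow_eq v w t
  have d (a b c : E) := (h.hasFDerivAt_fderiv_target_apply a b c).differentiableAt.hasFDerivAt
  have h2 := HasFDerivAt.congr_of_eventuallyEq ((h.hasFDerivAt_target_apply v w t).add
    ((((d v w t).add (d w v t)).sub (d t v w)).const_mul _)) h1
  rw [h2.fderiv]
  simp only [add_apply, sub_apply, smul_apply, smul_eq_mul, ContinuousLinearMap.comp_apply,
    ContinuousLinearMap.flip_apply]
  ring

theorem secondOrderPart_eq (h : IsIsometricNear G K f y) (u v w t : E) :
    secondOrderPart G y u v w t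
      = secondOrderPart K (f y) (fderiv ℝ f y u) (fderiv ℝ f y v) (fderiv ℝ f y w) (fderiv ℝ f y t)
        + K (f y) (fderiv ℝ (fderiv ℝ f) y v w) (fderiv ℝ (fderiv ℝ f) y u t)
        - K (f y) (fderiv ℝ (fderiv ℝ f) y u w) (fderiv ℝ (fderiv ℝ f) y v t)
        + christoffelLow K (f y) (fderiv ℝ f y u) (fderiv ℝ f y t) (fderiv ℝ (fderiv ℝ f) y v w)
        + christoffelLow K (f y) (fderiv ℝ f y v) (fderiv ℝ f y w) (fderiv ℝ (fderiv ℝ f) y u t)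
        - christoffelLow K (f y) (fderiv ℝ f y v) (fderiv ℝ f y t) (fderiv ℝ (fderiv ℝ f) y u w)
        - christoffelLow K (f y) (fderiv ℝ f y u) (fderiv ℝ f y w)
            (fderiv ℝ (fderiv ℝ f) y v t) := by
  rw [← h.source.fderiv_christoffelLow_sub, h.fderiv_christoffelLow, h.fderiv_christoffelLow]
  simp only [h.fderiv_fderiv_target_apply]
  simp only [secondOrderPart, christoffelLow]
  rw [h.fderiv_fderiv_fderiv_symm v u w, h.fderiv_fderiv_symm v u,
    h.target.fderiv_fderiv_symm (fderiv ℝ f y v) (fderiv ℝ f y u)]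
  have s := h.target.fderiv_symm
  generalize fderiv ℝ f y u = u', fderiv ℝ f y v = v', fderiv ℝ f y w = w',
    fderiv ℝ f y t = t', fderiv ℝ (fderiv ℝ f) y u v = uv, fderiv ℝ (fderiv ℝ f) y u w = uw,
    fderiv ℝ (fderiv ℝ f) y u t = ut, fderiv ℝ (fderiv ℝ f) y v w = vw,
    fderiv ℝ (fderiv ℝ f) y v t = vt
  linarith [s vw u' t', s u' vw t', s t' vw u', s uw v' t', s v' uw t', s t' uw v',
    s ut v' w', s v' ut w', s w' ut v', s vt u' w', s u' vt w', s w' vt u',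
    s uv w' t', s w' uv t', s t' uv w']

theorem fderiv_fderiv_eq (h : IsIsometricNear G K f y) (u v : E) :
    fderiv ℝ (fderiv ℝ f) y u v = chartSecondFundamentalForm G K f y u v
      - christoffel K (f y) (fderiv ℝ f y u) (fderiv ℝ f y v)
      + fderiv ℝ f y (christoffel G y u v) := by
  unfold chartSecondFundamentalForm
  rw [(h.hasFDerivAt_fderiv_apply v).fderiv, ContinuousLinearMap.flip_apply]
  abel

variable [FiniteDimensional ℝ E] [FiniteDimensional ℝ F]

theorem chartSecondFundamentalForm_symm (h : IsIsometricNear G K f y) (u v : E) :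
    chartSecondFundamentalForm G K f y u v = chartSecondFundamentalForm G K f y v u := by
  unfold chartSecondFundamentalForm
  rw [(h.hasFDerivAt_fderiv_apply v).fderiv, (h.hasFDerivAt_fderiv_apply u).fderiv,
    ContinuousLinearMap.flip_apply, ContinuousLinearMap.flip_apply, h.fderiv_fderiv_symm,
    h.source.christoffel_symm, h.target.christoffel_symm]

/-- The second fundamental form takes values in the normal space. -/
theorem chartSecondFundamentalForm_normal (h : IsIsometricNear G K f y) (u v w : E) :
    K (f y) (chartSecondFundamentalForm G K f y u v) (fderiv ℝ f y w) = 0 := by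
  have h1 := h.christoffelLow_eq u v w
  rw [← h.source.apply_christoffel, ← h.target.apply_christoffel, ← h.isometric_at,
    h.fderiv_fderiv_eq] at h1
  simp only [map_add, map_sub, add_apply, sub_apply] at h1
  linarith

/-- The **Gauss equation**. -/
theorem gauss_equation (h : IsIsometricNear G K f y) (u v w t : E) :
    G y (chartCurvature G y u v w) t
      = K (f y) (chartCurvature K (f y) (fderiv ℝ f y u) (fderiv ℝ f y v) (fderiv ℝ f y w))
          (fderiv ℝ f y t)
        + K (f y) (chartSecondFundamentalForm G K f y u t) (chartSecondFundamentalForm G K f y v w)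
        - K (f y) (chartSecondFundamentalForm G K f y v t)
            (chartSecondFundamentalForm G K f y u w) := by
  rw [h.source.apply_chartCurvature, h.target.apply_chartCurvature, h.secondOrderPart_eq]
  simp only [← h.target.apply_christoffel', ← h.isometric_at, h.fderiv_fderiv_eq]
  have n := h.chartSecondFundamentalForm_normal
  have n' (u v w : E) :
      K (f y) (fderiv ℝ f y w) (chartSecondFundamentalForm G K f y u v) = 0 := by
    rw [h.target.symm_at, n]
  have s := h.target.symm_at
  simp only [map_add, map_sub, add_apply, sub_apply, n, n']
  generalize chartSecondFundamentalForm G K f y u t = a₁, chartSecondFundamentalForm G K f y v w = b₁,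
    chartSecondFundamentalForm G K f y v t = c₁, chartSecondFundamentalForm G K f y u w = d₁,
    christoffel K (f y) (fderiv ℝ f y u) (fderiv ℝ f y t) = a₂,
    christoffel K (f y) (fderiv ℝ f y v) (fderiv ℝ f y w) = b₂,
    christoffel K (f y) (fderiv ℝ f y v) (fderiv ℝ f y t) = c₂,
    christoffel K (f y) (fderiv ℝ f y u) (fderiv ℝ f y w) = d₂,
    fderiv ℝ f y (christoffel G y u t) = a₃, fderiv ℝ f y (christoffel G y v w) = b₃,
    fderiv ℝ f y (christoffel G y v t) = c₃, fderiv ℝ f y (christoffel G y u w) = d₃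
  linarith [s a₁ b₁, s a₁ b₂, s a₁ b₃, s a₂ b₁, s a₂ b₂, s a₂ b₃, s a₃ b₁, s a₃ b₂, s a₃ b₃,
    s c₁ d₁, s c₁ d₂, s c₁ d₃, s c₂ d₁, s c₂ d₂, s c₂ d₃, s c₃ d₁, s c₃ d₂, s c₃ d₃]

end IsIsometricNear
end LocalIsometries

section DoublyWarpedCharts

variable {E₁ : Type*} [NormedAddCommGroup E₁] [NormedSpace ℝ E₁]
  {E₂ : Type*} [NormedAddCommGroup E₂] [NormedSpace ℝ E₂]

/-- The Hessian of `f` for the metric `G`. -/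
def chartHessian (G : E₁ → E₁ →L[ℝ] E₁ →L[ℝ] ℝ) (f : E₁ → ℝ) (y u v : E₁) : ℝ :=
  fderiv ℝ (fun z => fderiv ℝ f z v) y u - fderiv ℝ f y (christoffel G y u v)

theorem christoffel_const_smul [FiniteDimensional ℝ E₁] {G : E₁ → E₁ →L[ℝ] E₁ →L[ℝ] ℝ} {y : E₁}
    (hG : IsMetricNear G y) {c : ℝ} (hc : 0 < c) (u v : E₁) :
    christoffel (fun z => c • G z) y u v = christoffel G y u v := by
  have h : IsMetricNear (fun z => c • G z) y := by
    refine ⟨hG.contDiffAt.const_smul c, ?_, ?_⟩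
    · filter_upwards [hG.symm] with z hz u v
      simp [hz u v]
    · filter_upwards [hG.pos] with z hz v hv
      simpa using mul_pos hc (hz v hv)
  refine hG.ext_left fun w => ?_
  have h1 := h.apply_christoffel u v w
  have h2 : fderiv ℝ (fun z => c • G z) y = c • fderiv ℝ G y :=
    (hG.differentiableAt.hasFDerivAt.const_smul c).fderiv
  rw [hG.apply_christoffel]
  simp only [christoffelLow, h2, smul_apply, smul_eq_mul] at h1 ⊢
  refine mul_left_cancel₀ hc.ne' (h1.trans ?_)
  ring

/-- Near `y`, `G` is the doubly warped product metric `a₂² G₁ + a₁² G₂`. -/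
structure IsDoublyWarpedNear (G : E₁ × E₂ → E₁ × E₂ →L[ℝ] E₁ × E₂ →L[ℝ] ℝ)
    (G₁ : E₁ → E₁ →L[ℝ] E₁ →L[ℝ] ℝ) (G₂ : E₂ → E₂ →L[ℝ] E₂ →L[ℝ] ℝ) (a₁ : E₁ → ℝ) (a₂ : E₂ → ℝ)
    (y : E₁ × E₂) : Prop where
  metric : IsMetricNear G y
  metric₁ : IsMetricNear G₁ y.1
  metric₂ : IsMetricNear G₂ y.2
  contDiffAt₁ : ContDiffAt ℝ 2 a₁ y.1
  contDiffAt₂ : ContDiffAt ℝ 2 a₂ y.2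
  pos₁ : 0 < a₁ y.1
  pos₂ : 0 < a₂ y.2
  eq : ∀ᶠ z in 𝓝 y, ∀ u v, G z u v = a₂ z.2 ^ 2 * G₁ z.1 u.1 v.1 + a₁ z.1 ^ 2 * G₂ z.2 u.2 v.2

namespace IsDoublyWarpedNear

variable {G : E₁ × E₂ → E₁ × E₂ →L[ℝ] E₁ × E₂ →L[ℝ] ℝ}
  {G₁ : E₁ → E₁ →L[ℝ] E₁ →L[ℝ] ℝ} {G₂ : E₂ → E₂ →L[ℝ] E₂ →L[ℝ] ℝ} {a₁ : E₁ → ℝ} {a₂ : E₂ → ℝ}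
  {y : E₁ × E₂}

theorem eventually (h : IsDoublyWarpedNear G G₁ G₂ a₁ a₂ y) :
    ∀ᶠ z in 𝓝 y, IsDoublyWarpedNear G G₁ G₂ a₁ a₂ z := by
  have c₁ : Tendsto Prod.fst (𝓝 y) (𝓝 y.1) := continuous_fst.continuousAt
  have c₂ : Tendsto Prod.snd (𝓝 y) (𝓝 y.2) := continuous_snd.continuousAt
  filter_upwards [h.metric.eventually, c₁.eventually h.metric₁.eventually,
    c₂.eventually h.metric₂.eventually, c₁.eventually (h.contDiffAt₁.eventually (by simp)),
    c₂.eventually (h.contDiffAt₂.eventually (by simp)),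
    c₁.eventually (h.contDiffAt₁.continuousAt.eventually (lt_mem_nhds h.pos₁)),
    c₂.eventually (h.contDiffAt₂.continuousAt.eventually (lt_mem_nhds h.pos₂)),
    h.eq.eventually_nhds] with z h1 h2 h3 h4 h5 h6 h7 h8
  exact ⟨h1, h2, h3, h4, h5, h6, h7, h8⟩

theorem eq_at (h : IsDoublyWarpedNear G G₁ G₂ a₁ a₂ y) (u v : E₁ × E₂) :
    G y u v = a₂ y.2 ^ 2 * G₁ y.1 u.1 v.1 + a₁ y.1 ^ 2 * G₂ y.2 u.2 v.2 :=
  h.eq.self_of_nhds u v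

theorem hasFDerivAt₁ (h : IsDoublyWarpedNear G G₁ G₂ a₁ a₂ y) :
    HasFDerivAt (fun z : E₁ × E₂ => a₁ z.1)
      ((fderiv ℝ a₁ y.1).comp (ContinuousLinearMap.fst ℝ E₁ E₂)) y :=
  (h.contDiffAt₁.differentiableAt (by simp)).hasFDerivAt.comp y hasFDerivAt_fst

theorem hasFDerivAt₂ (h : IsDoublyWarpedNear G G₁ G₂ a₁ a₂ y) :
    HasFDerivAt (fun z : E₁ × E₂ => a₂ z.2)
      ((fderiv ℝ a₂ y.2).comp (ContinuousLinearMap.snd ℝ E₁ E₂)) y :=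
  (h.contDiffAt₂.differentiableAt (by simp)).hasFDerivAt.comp y hasFDerivAt_snd

theorem hasFDerivAt_metric₁ (h : IsDoublyWarpedNear G G₁ G₂ a₁ a₂ y) (v w : E₁) :
    HasFDerivAt (fun z : E₁ × E₂ => G₁ z.1 v w)
      ((((fderiv ℝ G₁ y.1).flip v).flip w).comp (ContinuousLinearMap.fst ℝ E₁ E₂)) y := by
  have := (h.metric₁.differentiableAt.hasFDerivAt.clm_apply (hasFDerivAt_const v y.1)).clm_apply
    (hasFDerivAt_const w y.1)
  refine (this.comp y (hasFDerivAt_fst (p := y))).congr_fderiv ?_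
  ext t <;> simp

theorem hasFDerivAt_metric₂ (h : IsDoublyWarpedNear G G₁ G₂ a₁ a₂ y) (v w : E₂) :
    HasFDerivAt (fun z : E₁ × E₂ => G₂ z.2 v w)
      ((((fderiv ℝ G₂ y.2).flip v).flip w).comp (ContinuousLinearMap.snd ℝ E₁ E₂)) y := by
  have := (h.metric₂.differentiableAt.hasFDerivAt.clm_apply (hasFDerivAt_const v y.2)).clm_apply
    (hasFDerivAt_const w y.2)
  refine (this.comp y (hasFDerivAt_snd (p := y))).congr_fderiv ?_
  ext t <;> simp

theorem fderiv_metric (h : IsDoublyWarpedNear G G₁ G₂ a₁ a₂ y) (u v w : E₁ × E₂) :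
    fderiv ℝ G y u v w
      = 2 * a₂ y.2 * fderiv ℝ a₂ y.2 u.2 * G₁ y.1 v.1 w.1
        + a₂ y.2 ^ 2 * fderiv ℝ G₁ y.1 u.1 v.1 w.1
        + 2 * a₁ y.1 * fderiv ℝ a₁ y.1 u.1 * G₂ y.2 v.2 w.2
        + a₁ y.1 ^ 2 * fderiv ℝ G₂ y.2 u.2 v.2 w.2 := by
  have h1 := (h.metric.differentiableAt.hasFDerivAt.clm_apply
    (hasFDerivAt_const v y)).clm_apply (hasFDerivAt_const w y)
  have h2 := ((h.hasFDerivAt₂.pow 2).mul (h.hasFDerivAt_metric₁ v.1 w.1)).add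
    ((h.hasFDerivAt₁.pow 2).mul (h.hasFDerivAt_metric₂ v.2 w.2))
  have h3 : (fun z => G z v w) =ᶠ[𝓝 y] fun z =>
      a₂ z.2 ^ 2 * G₁ z.1 v.1 w.1 + a₁ z.1 ^ 2 * G₂ z.2 v.2 w.2 := by
    filter_upwards [h.eq] with z hz using hz v w
  have := DFunLike.congr_fun (h1.unique (h2.congr_of_eventuallyEq h3)) u
  simp at this
  rw [this]
  ring

theorem fderiv_fderiv_apply_eq (h : IsMetricNear G y) (u v w t : E₁ × E₂) :
    fderiv ℝ (fderiv ℝ G) y u v w t = fderiv ℝ (fun z => fderiv ℝ G z v w t) y u := by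
  rw [(h.hasFDerivAt_fderiv_apply v w t).fderiv]
  simp

theorem fderiv_fderiv_metric₁ (h : IsDoublyWarpedNear G G₁ G₂ a₁ a₂ y) (u : E₁) (v : E₂) :
    fderiv ℝ (fderiv ℝ G) y (u, 0) (u, 0) (0, v) (0, v)
      = 2 * (fderiv ℝ a₁ y.1 u ^ 2 + a₁ y.1 * fderiv ℝ (fun z => fderiv ℝ a₁ z u) y.1 u)
        * G₂ y.2 v v := by
  rw [fderiv_fderiv_apply_eq h.metric]
  have h1 : (fun z => fderiv ℝ G z (u, 0) (0, v) (0, v)) =ᶠ[𝓝 y] fun z =>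
      2 * (a₁ z.1 * fderiv ℝ a₁ z.1 u * G₂ z.2 v v) := by
    filter_upwards [h.eventually] with z hz
    rw [hz.fderiv_metric]
    simp
    ring
  have h2 : DifferentiableAt ℝ (fun z => fderiv ℝ a₁ z u) y.1 :=
    ((h.contDiffAt₁.fderiv_right (m := 1) (by norm_num)).differentiableAt (by simp)).clm_apply
      (differentiableAt_const u)
  have h3 := ((h.hasFDerivAt₁.mul (h2.hasFDerivAt.comp y (hasFDerivAt_fst (p := y)))).mul
    (h.hasFDerivAt_metric₂ v v)).const_mul 2
  rw [(HasFDerivAt.congr_of_eventuallyEq h3 h1).fderiv]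
  simp
  ring

theorem fderiv_fderiv_metric₂ (h : IsDoublyWarpedNear G G₁ G₂ a₁ a₂ y) (u : E₁) (v : E₂) :
    fderiv ℝ (fderiv ℝ G) y (0, v) (0, v) (u, 0) (u, 0)
      = 2 * (fderiv ℝ a₂ y.2 v ^ 2 + a₂ y.2 * fderiv ℝ (fun z => fderiv ℝ a₂ z v) y.2 v)
        * G₁ y.1 u u := by
  rw [fderiv_fderiv_apply_eq h.metric]
  have h1 : (fun z => fderiv ℝ G z (0, v) (u, 0) (u, 0)) =ᶠ[𝓝 y] fun z =>
      2 * (a₂ z.2 * fderiv ℝ a₂ z.2 v * G₁ z.1 u u) := by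
    filter_upwards [h.eventually] with z hz
    rw [hz.fderiv_metric]
    simp
    ring
  have h2 : DifferentiableAt ℝ (fun z => fderiv ℝ a₂ z v) y.2 :=
    ((h.contDiffAt₂.fderiv_right (m := 1) (by norm_num)).differentiableAt (by simp)).clm_apply
      (differentiableAt_const v)
  have h3 := ((h.hasFDerivAt₂.mul (h2.hasFDerivAt.comp y (hasFDerivAt_snd (p := y)))).mul
    (h.hasFDerivAt_metric₁ u u)).const_mul 2
  rw [(HasFDerivAt.congr_of_eventuallyEq h3 h1).fderiv]
  simp
  ring

theorem fderiv_fderiv_metric_mixed (h : IsDoublyWarpedNear G G₁ G₂ a₁ a₂ y) (a b : E₁ × E₂)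
    (u : E₁) (v : E₂) : fderiv ℝ (fderiv ℝ G) y a b (u, 0) (0, v) = 0 := by
  rw [fderiv_fderiv_apply_eq h.metric]
  have h1 : (fun z => fderiv ℝ G z b (u, 0) (0, v)) =ᶠ[𝓝 y] fun _ => 0 := by
    filter_upwards [h.eventually] with z hz
    rw [hz.fderiv_metric]
    simp
  rw [h1.fderiv_eq]
  simp

theorem secondOrderPart_mixed (h : IsDoublyWarpedNear G G₁ G₂ a₁ a₂ y) (u : E₁) (v : E₂) :
    secondOrderPart G y (u, 0) (0, v) (0, v) (u, 0)
      = -(fderiv ℝ a₁ y.1 u ^ 2 + a₁ y.1 * fderiv ℝ (fun z => fderiv ℝ a₁ z u) y.1 u) * G₂ y.2 v v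
        - (fderiv ℝ a₂ y.2 v ^ 2 + a₂ y.2 * fderiv ℝ (fun z => fderiv ℝ a₂ z v) y.2 v)
          * G₁ y.1 u u := by
  simp only [secondOrderPart]
  rw [h.metric.fderiv_fderiv_symm' _ _ (0, v) (u, 0), h.fderiv_fderiv_metric_mixed,
    h.fderiv_fderiv_metric_mixed, h.fderiv_fderiv_metric₁, h.fderiv_fderiv_metric₂]
  ring

variable [FiniteDimensional ℝ E₁] [FiniteDimensional ℝ E₂]

theorem christoffel_mixed (h : IsDoublyWarpedNear G G₁ G₂ a₁ a₂ y) (u : E₁) (v : E₂) :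
    christoffel G y (u, 0) (0, v)
      = ((fderiv ℝ a₂ y.2 v / a₂ y.2) • u, (fderiv ℝ a₁ y.1 u / a₁ y.1) • v) := by
  refine h.metric.ext_left fun w => ?_
  have p₁ := h.pos₁.ne'
  have p₂ := h.pos₂.ne'
  rw [h.metric.apply_christoffel, christoffelLow, h.fderiv_metric, h.fderiv_metric,
    h.fderiv_metric, h.eq_at]
  simp
  field_simp
  ring

theorem christoffel_fst (h : IsDoublyWarpedNear G G₁ G₂ a₁ a₂ y) (u : E₁) :
    (christoffel G y (u, 0) (u, 0)).1 = christoffel G₁ y.1 u u := by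
  refine h.metric₁.ext_left fun w => ?_
  have h1 := h.metric.apply_christoffel (u, 0) (u, 0) (w, 0)
  rw [christoffelLow, h.fderiv_metric, h.fderiv_metric, h.eq_at] at h1
  rw [h.metric₁.apply_christoffel, christoffelLow]
  simp at h1
  refine mul_left_cancel₀ (pow_ne_zero 2 h.pos₂.ne') (h1.trans ?_)
  ring

theorem christoffel_snd (h : IsDoublyWarpedNear G G₁ G₂ a₁ a₂ y) (v : E₂) :
    (christoffel G y (0, v) (0, v)).2 = christoffel G₂ y.2 v v := by
  refine h.metric₂.ext_left fun w => ?_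
  have h1 := h.metric.apply_christoffel (0, v) (0, v) (0, w)
  rw [christoffelLow, h.fderiv_metric, h.fderiv_metric, h.eq_at] at h1
  rw [h.metric₂.apply_christoffel, christoffelLow]
  simp at h1
  refine mul_left_cancel₀ (pow_ne_zero 2 h.pos₁.ne') (h1.trans ?_)
  ring

theorem apply_christoffel_christoffel (h : IsDoublyWarpedNear G G₁ G₂ a₁ a₂ y) (u : E₁) (v : E₂) :
    G y (christoffel G y (u, 0) (u, 0)) (christoffel G y (0, v) (0, v))
      = -(a₁ y.1 * fderiv ℝ a₁ y.1 (christoffel G₁ y.1 u u) * G₂ y.2 v v)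
        - a₂ y.2 * fderiv ℝ a₂ y.2 (christoffel G₂ y.2 v v) * G₁ y.1 u u := by
  have h1 := h.metric.apply_christoffel (u, 0) (u, 0) (0, christoffel G₂ y.2 v v)
  have h2 := h.metric.apply_christoffel' (0, v) (0, v) (christoffel G₁ y.1 u u, 0)
  rw [christoffelLow, h.fderiv_metric, h.fderiv_metric, h.eq_at] at h1 h2
  rw [h.eq_at, h.christoffel_fst, h.christoffel_snd]
  simp at h1 h2
  rw [h1, h2]
  ring

/-- The mixed curvatures of a doubly warped product. -/
theorem apply_chartCurvature_mixed (h : IsDoublyWarpedNear G G₁ G₂ a₁ a₂ y) (u : E₁) (v : E₂) :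
    G y (chartCurvature G y (u, 0) (0, v) (0, v)) (u, 0)
      = -(a₁ y.1 * G₂ y.2 v v * chartHessian G₁ a₁ y.1 u u)
        - a₂ y.2 * G₁ y.1 u u * chartHessian G₂ a₂ y.2 v v := by
  have p₁ := h.pos₁.ne'
  have p₂ := h.pos₂.ne'
  rw [h.metric.apply_chartCurvature, h.secondOrderPart_mixed, h.apply_christoffel_christoffel,
    h.metric.christoffel_symm (0, v), h.christoffel_mixed, h.eq_at]
  simp only [chartHessian, map_smul, smul_apply, smul_eq_mul]
  field_simp
  ring

end IsDoublyWarpedNear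
end DoublyWarpedCharts

section Charts

variable {E : Type*} [NormedAddCommGroup E] [NormedSpace ℝ E]
  {H : Type*} [TopologicalSpace H] {I : ModelWithCorners ℝ E H}
  {M : Type*} [TopologicalSpace M] [ChartedSpace H M] [IsManifold I ∞ M]

theorem metricInChart_apply (g : RiemMetric I M) (p : M) (z u v : E) :
    metricInChart g p z u v = g.inner ((extChartAt I p).symm z)
      (mfderiv 𝓘(ℝ, E) I (extChartAt I p).symm z u)
      (mfderiv 𝓘(ℝ, E) I (extChartAt I p).symm z v) := rfl

theorem inner_congr (g : RiemMetric I M) {p q : M} (h : q = p) (u v : E) :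
    g.inner q u v = g.inner p u v := by
  subst h
  rfl

variable [I.Boundaryless]

theorem contMDiffAt_extChartAt_symm {p : M} {z : E} (hz : z ∈ (extChartAt I p).target) :
    ContMDiffAt 𝓘(ℝ, E) I ∞ (extChartAt I p).symm z :=
  (contMDiffOn_extChartAt_symm p).contMDiffAt ((isOpen_extChartAt_target p).mem_nhds hz)

theorem mdifferentiableAt_extChartAt_symm {p : M} {z : E} (hz : z ∈ (extChartAt I p).target) :
    MDifferentiableAt 𝓘(ℝ, E) I (extChartAt I p).symm z :=
  (contMDiffAt_extChartAt_symm hz).mdifferentiableAt (by simp)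

theorem metricInChart_self (g : RiemMetric I M) (p : M) (u v : E) :
    metricInChart g p (extChartAt I p p) u v = g.inner p u v := by
  have h : mfderiv 𝓘(ℝ, E) I (extChartAt I p).symm (extChartAt I p p)
      = ContinuousLinearMap.id ℝ E := by
    rw [← mfderivWithin_univ, ← I.range_eq_univ]
    exact mfderivWithin_range_extChartAt_symm
  rw [metricInChart_apply, h]
  exact inner_congr g (extChartAt_to_inv p) u v

theorem metricInChart_eq_inCoordinates (g : RiemMetric I M) {p : M} {z : E}
    (hz : z ∈ (extChartAt I p).target) :
    metricInChart g p z = ContinuousLinearMap.inCoordinates E (TangentSpace I : M → Type _)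
      (E →L[ℝ] ℝ) (fun q : M => TangentSpace I q →L[ℝ] ℝ) p ((extChartAt I p).symm z) p
      ((extChartAt I p).symm z) (g.inner ((extChartAt I p).symm z)) := by
  have hs : (extChartAt I p).symm z ∈ (chartAt H p).source := by
    rw [← extChartAt_source (I := I)]
    exact (extChartAt I p).map_target hz
  have hb : (extChartAt I p).symm z ∈ (trivializationAt E (TangentSpace I) p).baseSet := by
    simpa using hs
  have h := TangentBundle.symmL_trivializationAt (I := I) (𝕜 := ℝ) hs
  rw [I.range_eq_univ, mfderivWithin_univ, (extChartAt I p).right_inv hz] at h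
  ext u v
  have h' (w : E) : (trivializationAt E (TangentSpace I) p).symm ((extChartAt I p).symm z) w
      = mfderiv 𝓘(ℝ, E) I (extChartAt I p).symm z w :=
    (Trivialization.symmL_apply (hb := hb) ..).symm.trans (DFunLike.congr_fun h w)
  rw [inCoordinates_apply_eq₂ (F₃ := ℝ) (E₃ := fun _ => ℝ) hb hb (by simp), h' u, h' v]
  simp [metricInChart_apply]

theorem isMetricNear_metricInChart (g : RiemMetric I M) (p : M) :
    IsMetricNear (metricInChart g p) (extChartAt I p p) := by
  have ht := extChartAt_target_mem_nhds (I := I) p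
  refine ⟨?_, ?_, ?_⟩
  · have h0 : ContMDiffAt I 𝓘(ℝ, E →L[ℝ] E →L[ℝ] ℝ) ∞ (fun q =>
        ContinuousLinearMap.inCoordinates E (TangentSpace I : M → Type _)
          (E →L[ℝ] ℝ) (fun q : M => TangentSpace I q →L[ℝ] ℝ) p q p q (g.inner q))
          ((extChartAt I p).symm (extChartAt I p p)) := by
      rw [extChartAt_to_inv]
      exact ((contMDiffAt_hom_bundle _).mp (g.contMDiff p)).2
    have h1 := h0.comp (extChartAt I p p)
      (contMDiffAt_extChartAt_symm (mem_extChartAt_target p))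
    refine ((contMDiffAt_iff_contDiffAt.mp h1).of_le (by norm_cast)).congr_of_eventuallyEq ?_
    filter_upwards [ht] with z hz using metricInChart_eq_inCoordinates g hz
  · exact Eventually.of_forall fun z u v => g.symm _ _ _
  · filter_upwards [ht] with z hz v hv
    refine g.pos _ _ fun h0 => hv ?_
    have h := isInvertible_mfderivWithin_extChartAt_symm (I := I) hz
    rw [I.range_eq_univ, mfderivWithin_univ] at h
    exact h.injective (h0.trans (map_zero _).symm)

end Charts

section ImmersionCharts

variable {E : Type*} [NormedAddCommGroup E] [NormedSpace ℝ E]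
  {H : Type*} [TopologicalSpace H] {I : ModelWithCorners ℝ E H} [I.Boundaryless]
  {M : Type*} [TopologicalSpace M] [ChartedSpace H M]
  {F : Type*} [NormedAddCommGroup F] [NormedSpace ℝ F]
  {K : Type*} [TopologicalSpace K] {J : ModelWithCorners ℝ F K}
  {N : Type*} [TopologicalSpace N] [ChartedSpace K N]

theorem mfderiv_eq_fderiv_writtenInExtChartAt {x : M → N} {p : M} (hx : MDifferentiableAt I J x p) :
    mfderiv I J x p = fderiv ℝ (writtenInExtChartAt I J p x) (extChartAt I p p) := by
  rw [← fderivWithin_univ, ← I.range_eq_univ]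
  exact if_pos hx

variable [IsManifold I ∞ M] [J.Boundaryless] [IsManifold J ∞ N]

theorem IsIsometricImmersion.isIsometricNear {g : RiemMetric I M} {h : RiemMetric J N} {x : M → N}
    (hx : IsIsometricImmersion g h x) (p : M) :
    IsIsometricNear (metricInChart g p) (metricInChart h (x p)) (writtenInExtChartAt I J p x)
      (extChartAt I p p) := by
  have hc : ContDiffAt ℝ ∞ (writtenInExtChartAt I J p x) (extChartAt I p p) := by
    have := (contMDiffAt_iff.mp (hx.contMDiff p)).2
    rw [I.range_eq_univ, contDiffWithinAt_univ] at this
    exact this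
  have hy : writtenInExtChartAt I J p x (extChartAt I p p) = extChartAt J (x p) (x p) := by
    simp [writtenInExtChartAt]
  refine ⟨isMetricNear_metricInChart g p, ?_, hc.of_le (by norm_cast), ?_⟩
  · rw [hy]
    exact isMetricNear_metricInChart h (x p)
  have e1 : ∀ᶠ z in 𝓝 (extChartAt I p p),
      x ((extChartAt I p).symm z) ∈ (extChartAt J (x p)).source := by
    have : ContinuousAt (x ∘ (extChartAt I p).symm) (extChartAt I p p) :=
      hx.contMDiff.continuous.continuousAt.comp (continuousAt_extChartAt_symm p)
    refine this.eventually ((isOpen_extChartAt_source (x p)).mem_nhds ?_)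
    simp
  have e2 : ∀ᶠ z in 𝓝 (extChartAt I p p), ContDiffAt ℝ 1 (writtenInExtChartAt I J p x) z :=
    (hc.of_le (by norm_cast)).eventually (by simp)
  filter_upwards [extChartAt_target_mem_nhds (I := I) p, e1, e1.eventually_nhds, e2]
    with z hz h1 h2 h3 u v
  have e3 : (extChartAt J (x p)).symm ∘ writtenInExtChartAt I J p x
      =ᶠ[𝓝 z] x ∘ (extChartAt I p).symm := by
    filter_upwards [h2] with w hw
    exact (extChartAt J (x p)).left_inv hw
  have d1 := mfderiv_comp z
    (mdifferentiableAt_extChartAt_symm ((extChartAt J (x p)).map_source h1))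
    (h3.differentiableAt (by simp)).mdifferentiableAt
  have d2 := mfderiv_comp z ((hx.contMDiff _).mdifferentiableAt (by simp))
    (mdifferentiableAt_extChartAt_symm hz)
  have hz' : x ((extChartAt I p).symm z) = (extChartAt J (x p)).symm
      (writtenInExtChartAt I J p x z) := by
    exact ((extChartAt J (x p)).left_inv h1).symm
  have d3 (w : E) : mfderiv 𝓘(ℝ, F) J (extChartAt J (x p)).symm (writtenInExtChartAt I J p x z)
      (fderiv ℝ (writtenInExtChartAt I J p x) z w)
      = mfderiv I J x ((extChartAt I p).symm z) (mfderiv 𝓘(ℝ, E) I (extChartAt I p).symm z w) := by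
    have := DFunLike.congr_fun (d1.symm.trans (e3.mfderiv_eq.trans d2)) w
    rw [mfderiv_eq_fderiv] at this
    exact this
  rw [metricInChart_apply, ← hx.isometric]
  exact ((congrArg₂ (fun a b : F => h.inner _ a b) (d3 u) (d3 v)).trans
    (inner_congr h hz'.symm _ _)).symm

end ImmersionCharts

section DoublyWarpedMetrics

variable {E₁ : Type*} [NormedAddCommGroup E₁] [NormedSpace ℝ E₁] 
  {H₁ : Type*} [TopologicalSpace H₁] {I₁ : ModelWithCorners ℝ E₁ H₁} [I₁.Boundaryless]
  {M₁ : Type*} [TopologicalSpace M₁] [ChartedSpace H₁ M₁] [IsManifold I₁ ∞ M₁]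
  {E₂ : Type*} [NormedAddCommGroup E₂] [NormedSpace ℝ E₂] 
  {H₂ : Type*} [TopologicalSpace H₂] {I₂ : ModelWithCorners ℝ E₂ H₂} [I₂.Boundaryless]
  {M₂ : Type*} [TopologicalSpace M₂] [ChartedSpace H₂ M₂] [IsManifold I₂ ∞ M₂]

theorem WarpingFunction.contDiffAt_comp_symm (ρ : WarpingFunction I₁ M₁) (p : M₁) :
    ContDiffAt ℝ 2 (ρ ∘ (extChartAt I₁ p).symm) (extChartAt I₁ p p) :=
  (contMDiffAt_iff_contDiffAt.mp ((ρ.contMDiff _).comp _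
    (contMDiffAt_extChartAt_symm (mem_extChartAt_target p)))).of_le (by norm_cast)

variable [FiniteDimensional ℝ E₁] [FiniteDimensional ℝ E₂]

theorem metricInChart_doublyWarpedMetric (g₁ : RiemMetric I₁ M₁) (g₂ : RiemMetric I₂ M₂)
    (ρ₁ : WarpingFunction I₁ M₁) (ρ₂ : WarpingFunction I₂ M₂) (p : M₁ × M₂) {z : E₁ × E₂}
    (hz : z ∈ (extChartAt (I₁.prod I₂) p).target) (u v : E₁ × E₂) :
    metricInChart (doublyWarpedMetric g₁ g₂ ρ₁ ρ₂) p z u v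
      = ρ₂ ((extChartAt I₂ p.2).symm z.2) ^ 2 * metricInChart g₁ p.1 z.1 u.1 v.1
        + ρ₁ ((extChartAt I₁ p.1).symm z.1) ^ 2 * metricInChart g₂ p.2 z.2 u.2 v.2 := by
  have hs : (extChartAt (I₁.prod I₂) p).symm
      = fun z : E₁ × E₂ => ((extChartAt I₁ p.1).symm z.1, (extChartAt I₂ p.2).symm z.2) := by
    rw [extChartAt_prod]
    rfl
  have hz₁ : z.1 ∈ (extChartAt I₁ p.1).target := by
    rw [extChartAt_prod] at hz
    exact hz.1
  have hz₂ : z.2 ∈ (extChartAt I₂ p.2).target := by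
    rw [extChartAt_prod] at hz
    exact hz.2
  have d := mdifferentiableAt_extChartAt_symm hz
  have d₁ := mfderiv_comp z (mdifferentiableAt_extChartAt_symm hz₁)
    (differentiableAt_fst (𝕜 := ℝ) (p := z)).mdifferentiableAt
  have d₂ := mfderiv_comp z (mdifferentiableAt_extChartAt_symm hz₂)
    (differentiableAt_snd (𝕜 := ℝ) (p := z)).mdifferentiableAt
  have c₁ := mfderiv_comp z (mdifferentiableAt_fst (I := I₁) (I' := I₂)) d
  have c₂ := mfderiv_comp z (mdifferentiableAt_snd (I := I₁) (I' := I₂)) d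
  have e₁ (w : E₁ × E₂) :
      Prod.fst (show E₁ × E₂ from
        mfderiv 𝓘(ℝ, E₁ × E₂) (I₁.prod I₂) (extChartAt (I₁.prod I₂) p).symm z w)
      = mfderiv 𝓘(ℝ, E₁) I₁ (extChartAt I₁ p.1).symm z.1 w.1 := by
    rw [mfderiv_fst] at c₁
    rw [mfderiv_eq_fderiv, fderiv_fst] at d₁
    have hf : Prod.fst ∘ (extChartAt (I₁.prod I₂) p).symm = (extChartAt I₁ p.1).symm ∘ Prod.fst := by
      rw [hs]
      rfl
    rw [hf] at c₁
    exact (DFunLike.congr_fun (c₁.symm.trans d₁) w :)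
  have e₂ (w : E₁ × E₂) :
      Prod.snd (show E₁ × E₂ from
        mfderiv 𝓘(ℝ, E₁ × E₂) (I₁.prod I₂) (extChartAt (I₁.prod I₂) p).symm z w)
      = mfderiv 𝓘(ℝ, E₂) I₂ (extChartAt I₂ p.2).symm z.2 w.2 := by
    rw [mfderiv_snd] at c₂
    rw [mfderiv_eq_fderiv, fderiv_snd] at d₂
    have hf : Prod.snd ∘ (extChartAt (I₁.prod I₂) p).symm = (extChartAt I₂ p.2).symm ∘ Prod.snd := by
      rw [hs]
      rfl
    rw [hf] at c₂
    exact (DFunLike.congr_fun (c₂.symm.trans d₂) w :)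
  rw [metricInChart_apply, metricInChart_apply, metricInChart_apply, ← e₁, ← e₁, ← e₂, ← e₂]
  refine (doublyWarpedForm_apply g₁ g₂ ρ₁ ρ₂ _ _ _).trans ?_
  rw [hs]

theorem isDoublyWarpedNear_metricInChart (g₁ : RiemMetric I₁ M₁) (g₂ : RiemMetric I₂ M₂)
    (ρ₁ : WarpingFunction I₁ M₁) (ρ₂ : WarpingFunction I₂ M₂) (p : M₁ × M₂) :
    IsDoublyWarpedNear (metricInChart (doublyWarpedMetric g₁ g₂ ρ₁ ρ₂) p)
      (metricInChart g₁ p.1) (metricInChart g₂ p.2) (ρ₁ ∘ (extChartAt I₁ p.1).symm)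
      (ρ₂ ∘ (extChartAt I₂ p.2).symm) (extChartAt (I₁.prod I₂) p p) where
  metric := isMetricNear_metricInChart _ p
  metric₁ := isMetricNear_metricInChart g₁ p.1
  metric₂ := isMetricNear_metricInChart g₂ p.2
  contDiffAt₁ := ρ₁.contDiffAt_comp_symm p.1
  contDiffAt₂ := ρ₂.contDiffAt_comp_symm p.2
  pos₁ := ρ₁.pos _
  pos₂ := ρ₂.pos _
  eq := by
    filter_upwards [extChartAt_target_mem_nhds (I := I₁.prod I₂) p] with z hz u v
    exact metricInChart_doublyWarpedMetric g₁ g₂ ρ₁ ρ₂ p hz u v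

theorem christoffelAt_scaledMetric (g : RiemMetric I₁ M₁) {c : ℝ} (hc : 0 < c) (p : M₁)
    (u v : TangentSpace I₁ p) :
    christoffelAt (scaledMetric g c hc) p u v = christoffelAt g p u v :=
  christoffel_const_smul (isMetricNear_metricInChart g p) (pow_pos hc 2) u v

end DoublyWarpedMetrics

section Frames

variable {V W ι κ : Type*} [AddCommGroup V] [Module ℝ V] [AddCommGroup W] [Module ℝ W]
  [Fintype ι] [Fintype κ]

/-- `e` is an orthonormal basis of `P` for the scalar product `B`. -/
structure IsFrame (B : V → V → ℝ) (P : Submodule ℝ V) (e : ι → V) : Prop where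
  mem : ∀ i, e i ∈ P
  apply_self : ∀ i, B (e i) (e i) = 1
  apply_ne : ∀ i j, i ≠ j → B (e i) (e j) = 0
  expand : ∀ v ∈ P, ∑ i, B v (e i) • e i = v

/-- A bilinear map, as a property of a function. -/
structure IsBilinear (b : V → V → W) : Prop where
  left : ∀ v, IsLinearMap ℝ fun u => b u v
  right : ∀ u, IsLinearMap ℝ (b u)

theorem IsBilinear.sum_smul_left {b : V → V → W} (hb : IsBilinear b) (c : ι → ℝ) (e : ι → V)
    (v : V) : b (∑ i, c i • e i) v = ∑ i, c i • b (e i) v := by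
  exact (map_sum (hb.left v).mk' (fun i => c i • e i) Finset.univ).trans
    (Finset.sum_congr rfl fun i _ => (hb.left v).map_smul (c i) (e i))

theorem IsBilinear.sum_smul_right {b : V → V → W} (hb : IsBilinear b) (c : ι → ℝ) (e : ι → V)
    (u : V) : b u (∑ i, c i • e i) = ∑ i, c i • b u (e i) := by
  exact (map_sum (hb.right u).mk' (fun i => c i • e i) Finset.univ).trans
    (Finset.sum_congr rfl fun i _ => (hb.right u).map_smul (c i) (e i))

/-- The trace of a bilinear map does not depend on the orthonormal basis. -/
theorem IsFrame.trace_eq {B : V → V → ℝ} (hB : ∀ u v, B u v = B v u) {P : Submodule ℝ V}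
    {e : ι → V} {e' : κ → V} (he : IsFrame B P e) (he' : IsFrame B P e') {b : V → V → W}
    (hb : IsBilinear b) : ∑ i, b (e i) (e i) = ∑ j, b (e' j) (e' j) := by
  calc ∑ i, b (e i) (e i) = ∑ i, ∑ j, B (e i) (e' j) • b (e i) (e' j) := by
        refine Finset.sum_congr rfl fun i _ => ?_
        rw [← hb.sum_smul_right, he'.expand _ (he.mem i)]
    _ = ∑ j, ∑ i, B (e' j) (e i) • b (e i) (e' j) := by
        rw [Finset.sum_comm]
        simp only [hB]
    _ = ∑ j, b (e' j) (e' j) := by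
        refine Finset.sum_congr rfl fun j _ => ?_
        rw [← hb.sum_smul_left, he.expand _ (he'.mem j)]

theorem IsFrame.bilinear_eq_zero {B : V → V → ℝ} {P Q : Submodule ℝ V} {e : ι → V} {e' : κ → V}
    (he : IsFrame B P e) (he' : IsFrame B Q e') {b : V → V → W} (hb : IsBilinear b)
    (h : ∀ i j, b (e i) (e' j) = 0) {u v : V} (hu : u ∈ P) (hv : v ∈ Q) : b u v = 0 := by
  rw [← he.expand u hu, hb.sum_smul_left]
  refine Finset.sum_eq_zero fun i _ => ?_
  rw [← he'.expand v hv, hb.sum_smul_right]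
  simp [h]

theorem IsFrame.map {B : V → V → ℝ} {P : Submodule ℝ V} {e : ι → V} (he : IsFrame B P e)
    {B' : W → W → ℝ} (A : V →ₗ[ℝ] W) (hA : ∀ u v, B' (A u) (A v) = B u v) :
    IsFrame B' (P.map A) fun i => A (e i) where
  mem i := Submodule.mem_map_of_mem (he.mem i)
  apply_self i := by rw [hA, he.apply_self]
  apply_ne i j h := by rw [hA, he.apply_ne i j h]
  expand w hw := by
    obtain ⟨v, hv, rfl⟩ := hw
    conv_rhs => rw [← he.expand v hv]
    simp [hA]

theorem IsFrame.sumElim {B : V → V → ℝ} {P Q : Submodule ℝ V} {e : ι → V} {e' : κ → V}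
    (he : IsFrame B P e) (he' : IsFrame B Q e') (hB : IsBilinear B) (hPQ : P ⊔ Q = ⊤)
    (h : ∀ u ∈ P, ∀ v ∈ Q, B u v = 0) (h' : ∀ u ∈ P, ∀ v ∈ Q, B v u = 0) :
    IsFrame B ⊤ (Sum.elim e e') where
  mem _ := trivial
  apply_self i := by
    cases i
    · exact he.apply_self _
    · exact he'.apply_self _
  apply_ne i j hij := by
    cases i <;> cases j
    · exact he.apply_ne _ _ fun h0 => hij (by rw [h0])
    · exact h _ (he.mem _) _ (he'.mem _)
    · exact h' _ (he.mem _) _ (he'.mem _)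
    · exact he'.apply_ne _ _ fun h0 => hij (by rw [h0])
  expand v _ := by
    obtain ⟨a, ha, b, hb, rfl⟩ := Submodule.mem_sup.mp (hPQ ▸ Submodule.mem_top : v ∈ P ⊔ Q)
    have e1 (i : ι) : B (a + b) (e i) = B a (e i) := by
      rw [(hB.left _).map_add, h' _ (he.mem i) _ hb, add_zero]
    have e2 (j : κ) : B (a + b) (e' j) = B b (e' j) := by
      rw [(hB.left _).map_add, h _ ha _ (he'.mem j), zero_add]
    rw [Fintype.sum_sum_type]
    simp only [Sum.elim_inl, Sum.elim_inr, e1, e2]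
    rw [he.expand a ha, he'.expand b hb]

theorem sum_sum_Ioi_eq {n : ℕ} {f : Fin n → Fin n → ℝ} (hs : ∀ i j, f i j = f j i)
    (h0 : ∀ i, f i i = 0) : ∑ i, ∑ j ∈ Finset.Ioi i, f i j = 1 / 2 * ∑ i, ∑ j, f i j := by
  have h1 := Finset.sum_sum_Ioi_add_eq_sum_sum_off_diag f
  have h2 : ∑ i, ∑ j ∈ Finset.Ioi i, (f j i + f i j) = 2 * ∑ i, ∑ j ∈ Finset.Ioi i, f i j := by
    simp only [Finset.mul_sum]
    refine Finset.sum_congr rfl fun i _ => Finset.sum_congr rfl fun j _ => ?_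
    rw [hs j i]
    ring
  have h3 : ∑ i, ∑ j ∈ {i}ᶜ, f j i = ∑ i, ∑ j, f i j := by
    refine Finset.sum_congr rfl fun i _ => ?_
    rw [← Finset.sum_compl_add_sum {i}]
    simp [h0, hs i]
  linarith

end Frames

section BilinearCharts

variable {E : Type*} [NormedAddCommGroup E] [NormedSpace ℝ E] [FiniteDimensional ℝ E]
  {F : Type*} [NormedAddCommGroup F] [NormedSpace ℝ F] [FiniteDimensional ℝ F]

theorem IsMetricNear.isBilinear_chartCurvature {G : E → E →L[ℝ] E →L[ℝ] ℝ} {y : E}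
    (hG : IsMetricNear G y) (v : E) :
    IsBilinear fun u t => G y (chartCurvature G y u v v) t where
  left t := by
    simp only [hG.apply_chartCurvature, secondOrderPart]
    constructor
    · intro a b
      simp only [christoffel_add_left, map_add, add_apply]
      ring
    · intro c a
      simp only [christoffel_smul_left, map_smul, smul_apply, smul_eq_mul]
      ring
  right u := ⟨fun a b => map_add _ _ _, fun c a => map_smul _ _ _⟩

theorem IsIsometricNear.isBilinear_chartSecondFundamentalForm {G : E → E →L[ℝ] E →L[ℝ] ℝ}
    {K : F → F →L[ℝ] F →L[ℝ] ℝ} {f : E → F} {y : E} (h : IsIsometricNear G K f y) :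
    IsBilinear (chartSecondFundamentalForm G K f y) := by
  have hl (v : E) : IsLinearMap ℝ fun u => chartSecondFundamentalForm G K f y u v := by
    unfold chartSecondFundamentalForm
    constructor
    · intro a b
      simp only [christoffel_add_left, map_add]
      abel
    · intro c a
      simp only [christoffel_smul_left, map_smul]
      module
  refine ⟨hl, fun u => ?_⟩
  have hs : chartSecondFundamentalForm G K f y u
      = fun v => chartSecondFundamentalForm G K f y v u := by
    ext v
    rw [h.chartSecondFundamentalForm_symm]
  rw [hs]
  exact hl u

end BilinearCharts

section MetricFrames

variable {E : Type*} [NormedAddCommGroup E] [NormedSpace ℝ E]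
  {H : Type*} [TopologicalSpace H] {I : ModelWithCorners ℝ E H}
  {M : Type*} [TopologicalSpace M] [ChartedSpace H M] [IsManifold I ∞ M]

theorem isBilinear_inner (g : RiemMetric I M) (p : M) :
    IsBilinear fun u v : TangentSpace I p => g.inner p u v where
  left v := ⟨fun a b => by simp, fun c a => by simp⟩
  right u := ⟨fun a b => by simp, fun c a => by simp⟩

theorem RiemMetric.inner_self_nonneg (g : RiemMetric I M) (p : M) (v : TangentSpace I p) :
    0 ≤ g.inner p v v := by
  rcases eq_or_ne v 0 with rfl | hv
  · simp
  · exact (g.pos p v hv).le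

theorem RiemMetric.inner_self_eq_zero (g : RiemMetric I M) {p : M} {v : TangentSpace I p} :
    g.inner p v v = 0 ↔ v = 0 := by
  refine ⟨fun h0 => ?_, fun h0 => by simp [h0]⟩
  by_contra hv
  exact (g.pos p v hv).ne' h0

theorem IsOrthonormalBasisOf.isFrame [FiniteDimensional ℝ E] {g : RiemMetric I M} {p : M}
    {P : Submodule ℝ (TangentSpace I p)} {e : Fin (Module.finrank ℝ P) → TangentSpace I p}
    (he : IsOrthonormalBasisOf g p P e) : IsFrame (fun u v => g.inner p u v) P e := by
  have key (c : Fin (Module.finrank ℝ P) → ℝ) (j) :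
      g.inner p (∑ i, c i • e i) (e j) = c j := by
    simp [he.2]
  let b : Fin (Module.finrank ℝ P) → P := fun i => ⟨e i, he.1 i⟩
  have hli : LinearIndependent ℝ b := by
    rw [Fintype.linearIndependent_iff]
    intro c hc i
    have h0 : ∑ i, c i • e i = 0 := by
      have := congrArg Subtype.val hc
      simpa [b] using this
    have := key c i
    rw [h0] at this
    simpa using this.symm
  have _ : FiniteDimensional ℝ (TangentSpace I p) := inferInstanceAs (FiniteDimensional ℝ E)
  have hsp := hli.span_eq_top_of_card_eq_finrank' (by simp)
  refine ⟨he.1, fun i => by simp [he.2], fun i j h => by simp [he.2, h], fun v hv => ?_⟩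
  have hv' : (⟨v, hv⟩ : P) ∈ Submodule.span ℝ (range b) := by
    rw [hsp]
    trivial
  obtain ⟨c, hc⟩ := (Submodule.mem_span_range_iff_exists_fun ℝ).mp hv'
  have hc' : v = ∑ i, c i • e i := by
    have := congrArg Subtype.val hc
    simpa [b] using this.symm
  conv_rhs => rw [hc']
  refine Finset.sum_congr rfl fun i _ => ?_
  rw [← key c i, ← hc']

theorem isFrame_orthonormalFrame [FiniteDimensional ℝ E] (g : RiemMetric I M) (p : M)
    (P : Submodule ℝ (TangentSpace I p)) :
    IsFrame (fun u v => g.inner p u v) P (orthonormalFrame g p P) :=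
  (exists_isOrthonormalBasisOf g p P).choose_spec.isFrame

end MetricFrames

section Curvature

variable {E : Type*} [NormedAddCommGroup E] [NormedSpace ℝ E]
  {H : Type*} [TopologicalSpace H] {I : ModelWithCorners ℝ E H} [I.Boundaryless]
  {M : Type*} [TopologicalSpace M] [ChartedSpace H M] [IsManifold I ∞ M]

theorem inner_riemannCurvature (g : RiemMetric I M) (p : M) (u v w t : TangentSpace I p) :
    g.inner p (riemannCurvature g p u v w) t
      = metricInChart g p (extChartAt I p p)
          (chartCurvature (metricInChart g p) (extChartAt I p p) u v w) t :=
  (metricInChart_self g p _ _).symm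

variable [FiniteDimensional ℝ E]

theorem inner_riemannCurvature_self (g : RiemMetric I M) (p : M) (u w t : TangentSpace I p) :
    g.inner p (riemannCurvature g p u u w) t = 0 := by
  have := (isMetricNear_metricInChart g p).chartCurvature_antisymm u u w t
  rw [inner_riemannCurvature]
  linarith

theorem inner_riemannCurvature_symm (g : RiemMetric I M) (p : M) (u v : TangentSpace I p) :
    g.inner p (riemannCurvature g p u v v) u = g.inner p (riemannCurvature g p v u u) v := by
  have h1 := (isMetricNear_metricInChart g p).chartCurvature_antisymm u v v u
  have h2 := (isMetricNear_metricInChart g p).chartCurvature_antisymm' v u v u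
  rw [inner_riemannCurvature, inner_riemannCurvature]
  linarith

theorem isBilinear_inner_riemannCurvature (g : RiemMetric I M) (p : M) (v : TangentSpace I p) :
    IsBilinear fun u t => g.inner p (riemannCurvature g p u v v) t := by
  simp only [inner_riemannCurvature]
  exact (isMetricNear_metricInChart g p).isBilinear_chartCurvature v

theorem scalarCurvature_eq (g : RiemMetric I M) (p : M) {P : Submodule ℝ (TangentSpace I p)}
    {ι : Type*} [Fintype ι] {e : ι → TangentSpace I p}
    (he : IsFrame (fun u v => g.inner p u v) P e) :
    scalarCurvature g p P
      = 1 / 2 * ∑ i, ∑ j, g.inner p (riemannCurvature g p (e i) (e j) (e j)) (e i) := by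
  have hc := isFrame_orthonormalFrame g p P
  unfold scalarCurvature
  generalize orthonormalFrame g p P = c at hc
  have h1 : ∑ i, ∑ j ∈ Finset.Ioi i, sectionalCurvature g p (c i) (c j)
      = ∑ i, ∑ j ∈ Finset.Ioi i, g.inner p (riemannCurvature g p (c i) (c j) (c j)) (c i) := by
    refine Finset.sum_congr rfl fun i _ => Finset.sum_congr rfl fun j hj => ?_
    rw [sectionalCurvature, hc.apply_self, hc.apply_self,
      hc.apply_ne _ _ (Finset.mem_Ioi.mp hj).ne]
    norm_num
  have h2 (v : TangentSpace I p) := hc.trace_eq (fun u v => g.symm p u v) he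
    (isBilinear_inner_riemannCurvature g p v)
  rw [h1, sum_sum_Ioi_eq (fun i j => inner_riemannCurvature_symm g p (c i) (c j))
    (fun i => inner_riemannCurvature_self g p (c i) (c i) (c i)), Finset.sum_comm]
  simp only [h2]
  rw [Finset.sum_comm]
  simp only [inner_riemannCurvature_symm g p (e _) (c _), h2]
  simp only [inner_riemannCurvature_symm g p (e _) (e _)]

theorem scalarCurvature_sub_sub (g : RiemMetric I M) (p : M) {P Q R : Submodule ℝ (TangentSpace I p)}
    {ι κ : Type*} [Fintype ι] [Fintype κ] {e : ι ⊕ κ → TangentSpace I p} {e₁ : ι → TangentSpace I p}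
    {e₂ : κ → TangentSpace I p} (he : IsFrame (fun u v => g.inner p u v) R e)
    (he₁ : IsFrame (fun u v => g.inner p u v) P e₁) (he₂ : IsFrame (fun u v => g.inner p u v) Q e₂)
    (hl : ∀ i, e (.inl i) = e₁ i) (hr : ∀ j, e (.inr j) = e₂ j) :
    scalarCurvature g p R - scalarCurvature g p P - scalarCurvature g p Q
      = ∑ i, ∑ j, g.inner p (riemannCurvature g p (e₁ i) (e₂ j) (e₂ j)) (e₁ i) := by
  rw [scalarCurvature_eq g p he, scalarCurvature_eq g p he₁, scalarCurvature_eq g p he₂]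
  simp only [Fintype.sum_sum_type, Finset.sum_add_distrib, hl, hr]
  have hs : ∑ j, ∑ i, g.inner p (riemannCurvature g p (e₂ j) (e₁ i) (e₁ i)) (e₂ j)
      = ∑ i, ∑ j, g.inner p (riemannCurvature g p (e₁ i) (e₂ j) (e₂ j)) (e₁ i) := by
    rw [Finset.sum_comm]
    simp only [inner_riemannCurvature_symm g p (e₂ _) (e₁ _)]
  rw [hs]
  ring

end Curvature

section Immersions

variable {E : Type*} [NormedAddCommGroup E] [NormedSpace ℝ E]
  {H : Type*} [TopologicalSpace H] {I : ModelWithCorners ℝ E H}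
  {M : Type*} [TopologicalSpace M] [ChartedSpace H M]
  {F : Type*} [NormedAddCommGroup F] [NormedSpace ℝ F]
  {K : Type*} [TopologicalSpace K] {J : ModelWithCorners ℝ F K}
  {N : Type*} [TopologicalSpace N] [ChartedSpace K N]

theorem writtenInExtChartAt_self (x : M → N) (p : M) :
    writtenInExtChartAt I J p x (extChartAt I p p) = extChartAt J (x p) (x p) := by
  simp [writtenInExtChartAt]

variable [IsManifold I ∞ M] [IsManifold J ∞ N]
  {g : RiemMetric I M} {h : RiemMetric J N} {x : M → N}

theorem IsFrame.tangentImage (hx : IsIsometricImmersion g h x) {p : M}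
    {P : Submodule ℝ (TangentSpace I p)} {ι : Type*} [Fintype ι] {e : ι → TangentSpace I p}
    (he : IsFrame (fun u v => g.inner p u v) P e) :
    IsFrame (fun u v => h.inner (x p) u v) (tangentImage I J x p P) fun i => mfderiv I J x p (e i) :=
  he.map (mfderiv I J x p).toLinearMap fun u v => hx.isometric p u v

variable [I.Boundaryless]

theorem IsIsometricImmersion.secondFundamentalForm_eq (hx : IsIsometricImmersion g h x) (p : M)
    (u v : TangentSpace I p) :
    secondFundamentalForm g h x p u v = chartSecondFundamentalForm (metricInChart g p)
      (metricInChart h (x p)) (writtenInExtChartAt I J p x) (extChartAt I p p) u v := by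
  have hd := mfderiv_eq_fderiv_writtenInExtChartAt ((hx.contMDiff p).mdifferentiableAt (by simp))
  unfold secondFundamentalForm chartSecondFundamentalForm
  rw [writtenInExtChartAt_self, hd]
  rfl

variable [FiniteDimensional ℝ E] [FiniteDimensional ℝ F] [J.Boundaryless]

theorem IsIsometricImmersion.isBilinear (hx : IsIsometricImmersion g h x) (p : M) :
    IsBilinear fun u v => secondFundamentalForm g h x p u v := by
  simp only [hx.secondFundamentalForm_eq]
  exact (hx.isIsometricNear p).isBilinear_chartSecondFundamentalForm

theorem IsIsometricImmersion.secondFundamentalForm_symm (hx : IsIsometricImmersion g h x) (p : M)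
    (u v : TangentSpace I p) :
    secondFundamentalForm g h x p u v = secondFundamentalForm g h x p v u := by
  rw [hx.secondFundamentalForm_eq, hx.secondFundamentalForm_eq]
  exact (hx.isIsometricNear p).chartSecondFundamentalForm_symm u v

theorem IsIsometricImmersion.gauss_equation (hx : IsIsometricImmersion g h x) (p : M)
    (u v w t : TangentSpace I p) :
    g.inner p (riemannCurvature g p u v w) t
      = h.inner (x p) (riemannCurvature h (x p) (mfderiv I J x p u) (mfderiv I J x p v)
          (mfderiv I J x p w)) (mfderiv I J x p t)
        + h.inner (x p) (secondFundamentalForm g h x p u t) (secondFundamentalForm g h x p v w)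
        - h.inner (x p) (secondFundamentalForm g h x p v t)
            (secondFundamentalForm g h x p u w) := by
  have hd := mfderiv_eq_fderiv_writtenInExtChartAt ((hx.contMDiff p).mdifferentiableAt (by simp))
  have hg := (hx.isIsometricNear p).gauss_equation u v w t
  rw [writtenInExtChartAt_self] at hg
  simp only [metricInChart_self] at hg
  simp only [hx.secondFundamentalForm_eq]
  rw [inner_riemannCurvature, hd]
  exact hg

theorem finrank_smul_partialMeanCurvature (hx : IsIsometricImmersion g h x) {p : M}
    {P : Submodule ℝ (TangentSpace I p)} {ι : Type*} [Fintype ι] {e : ι → TangentSpace I p}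
    (he : IsFrame (fun u v => g.inner p u v) P e) :
    (Module.finrank ℝ P : ℝ) • partialMeanCurvature g h x p P
      = ∑ i, secondFundamentalForm g h x p (e i) (e i) := by
  rw [← (isFrame_orthonormalFrame g p P).trace_eq (fun u v => g.symm p u v) he (hx.isBilinear p)]
  unfold partialMeanCurvature
  rcases eq_or_ne (Module.finrank ℝ P) 0 with h0 | h0
  · have : IsEmpty (Fin (Module.finrank ℝ P)) := by
      rw [h0]
      infer_instance
    simp
  · rw [smul_smul, mul_one_div_cancel (by exact_mod_cast h0), one_smul]

end Immersions

section LeafTangents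

variable {E₁ : Type*} [NormedAddCommGroup E₁] [NormedSpace ℝ E₁]
  {H₁ : Type*} [TopologicalSpace H₁] {I₁ : ModelWithCorners ℝ E₁ H₁}
  {M₁ : Type*} [TopologicalSpace M₁] [ChartedSpace H₁ M₁]
  {E₂ : Type*} [NormedAddCommGroup E₂] [NormedSpace ℝ E₂]
  {H₂ : Type*} [TopologicalSpace H₂] {I₂ : ModelWithCorners ℝ E₂ H₂}
  {M₂ : Type*} [TopologicalSpace M₂] [ChartedSpace H₂ M₂]

theorem leafTangent₁_eq (p : M₁ × M₂) :
    leafTangent₁ I₁ I₂ p = LinearMap.range (LinearMap.inl ℝ E₁ E₂) := by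
  unfold leafTangent₁
  rw [mfderiv_snd]
  ext v
  refine Iff.trans (b := Prod.snd (show E₁ × E₂ from v) = 0) Iff.rfl ?_
  constructor
  · intro h
    exact ⟨Prod.fst (show E₁ × E₂ from v), Prod.ext rfl h.symm⟩
  · rintro ⟨u, rfl⟩
    rfl

theorem leafTangent₂_eq (p : M₁ × M₂) :
    leafTangent₂ I₁ I₂ p = LinearMap.range (LinearMap.inr ℝ E₁ E₂) := by
  unfold leafTangent₂
  rw [mfderiv_fst]
  ext v
  refine Iff.trans (b := Prod.fst (show E₁ × E₂ from v) = 0) Iff.rfl ?_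
  constructor
  · intro h
    exact ⟨Prod.snd (show E₁ × E₂ from v), Prod.ext h.symm rfl⟩
  · rintro ⟨u, rfl⟩
    rfl

theorem finrank_leafTangent₁ (p : M₁ × M₂) :
    Module.finrank ℝ (leafTangent₁ I₁ I₂ p) = Module.finrank ℝ E₁ := by
  exact (congrArg (fun P : Submodule ℝ (E₁ × E₂) => Module.finrank ℝ P)
    (leafTangent₁_eq (I₁ := I₁) (I₂ := I₂) p)).trans
    (LinearMap.finrank_range_of_inj LinearMap.inl_injective)

theorem finrank_leafTangent₂ (p : M₁ × M₂) :
    Module.finrank ℝ (leafTangent₂ I₁ I₂ p) = Module.finrank ℝ E₂ := by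
  exact (congrArg (fun P : Submodule ℝ (E₁ × E₂) => Module.finrank ℝ P)
    (leafTangent₂_eq (I₁ := I₁) (I₂ := I₂) p)).trans
    (LinearMap.finrank_range_of_inj LinearMap.inr_injective)

theorem leafTangent₁_sup_leafTangent₂ (p : M₁ × M₂) :
    leafTangent₁ I₁ I₂ p ⊔ leafTangent₂ I₁ I₂ p = ⊤ := by
  rw [leafTangent₁_eq, leafTangent₂_eq]
  exact LinearMap.sup_range_inl_inr

variable [IsManifold I₁ ∞ M₁] [IsManifold I₂ ∞ M₂]
  [FiniteDimensional ℝ E₁] [FiniteDimensional ℝ E₂]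
  (g₁ : RiemMetric I₁ M₁) (g₂ : RiemMetric I₂ M₂)
  (ρ₁ : WarpingFunction I₁ M₁) (ρ₂ : WarpingFunction I₂ M₂) (p : M₁ × M₂)

theorem IsFrame.inl {ι : Type*} [Fintype ι] {e : ι → E₁}
    (he : IsFrame (fun u v : E₁ => (scaledMetric g₁ (ρ₂ p.2) (ρ₂.pos p.2)).inner p.1 u v) ⊤ e) :
    IsFrame (fun u v => (doublyWarpedMetric g₁ g₂ ρ₁ ρ₂).inner p u v) (leafTangent₁ I₁ I₂ p)
      fun i => ((e i, 0) : E₁ × E₂) := by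
  rw [leafTangent₁_eq, LinearMap.range_eq_map]
  refine he.map (W := E₁ × E₂) (LinearMap.inl ℝ E₁ E₂) fun u v => ?_
  refine (doublyWarpedForm_apply g₁ g₂ ρ₁ ρ₂ p ((u, 0) : E₁ × E₂) ((v, 0) : E₁ × E₂)).trans ?_
  have h0 : g₂.inner p.2 (0 : E₂) (0 : E₂) = 0 := map_zero (g₂.inner p.2 (0 : E₂))
  change ρ₂ p.2 ^ 2 * g₁.inner p.1 u v + ρ₁ p.1 ^ 2 * g₂.inner p.2 (0 : E₂) (0 : E₂) = _
  rw [h0, mul_zero, add_zero]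
  rfl

theorem IsFrame.inr {ι : Type*} [Fintype ι] {e : ι → E₂}
    (he : IsFrame (fun u v : E₂ => (scaledMetric g₂ (ρ₁ p.1) (ρ₁.pos p.1)).inner p.2 u v) ⊤ e) :
    IsFrame (fun u v => (doublyWarpedMetric g₁ g₂ ρ₁ ρ₂).inner p u v) (leafTangent₂ I₁ I₂ p)
      fun i => ((0, e i) : E₁ × E₂) := by
  rw [leafTangent₂_eq, LinearMap.range_eq_map]
  refine he.map (W := E₁ × E₂) (LinearMap.inr ℝ E₁ E₂) fun u v => ?_
  refine (doublyWarpedForm_apply g₁ g₂ ρ₁ ρ₂ p ((0, u) : E₁ × E₂) ((0, v) : E₁ × E₂)).trans ?_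
  have h0 : g₁.inner p.1 (0 : E₁) (0 : E₁) = 0 := map_zero (g₁.inner p.1 (0 : E₁))
  change ρ₂ p.2 ^ 2 * g₁.inner p.1 (0 : E₁) (0 : E₁) + ρ₁ p.1 ^ 2 * g₂.inner p.2 u v = _
  rw [h0, mul_zero, zero_add]
  rfl

theorem inner_leafTangent₁_leafTangent₂ {X Z : TangentSpace (I₁.prod I₂) p}
    (hX : X ∈ leafTangent₁ I₁ I₂ p) (hZ : Z ∈ leafTangent₂ I₁ I₂ p) :
    (doublyWarpedMetric g₁ g₂ ρ₁ ρ₂).inner p X Z = 0 := by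
  rw [leafTangent₁_eq] at hX
  rw [leafTangent₂_eq] at hZ
  obtain ⟨u, rfl⟩ := hX
  obtain ⟨v, rfl⟩ := hZ
  refine (doublyWarpedForm_apply g₁ g₂ ρ₁ ρ₂ p ((u, 0) : E₁ × E₂) ((0, v) : E₁ × E₂)).trans ?_
  have h1 : g₁.inner p.1 u (0 : E₁) = 0 := map_zero (g₁.inner p.1 u)
  have h2 : g₂.inner p.2 (0 : E₂) v = 0 :=
    (g₂.symm p.2 (0 : E₂) v).trans (map_zero (g₂.inner p.2 v))
  change ρ₂ p.2 ^ 2 * g₁.inner p.1 u (0 : E₁) + ρ₁ p.1 ^ 2 * g₂.inner p.2 (0 : E₂) v = 0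
  rw [h1, h2, mul_zero, mul_zero, add_zero]

theorem IsFrame.sumElim_inl_inr {ι κ : Type*} [Fintype ι] [Fintype κ] {e₁ : ι → E₁} {e₂ : κ → E₂}
    (he₁ : IsFrame (fun u v : E₁ => (scaledMetric g₁ (ρ₂ p.2) (ρ₂.pos p.2)).inner p.1 u v) ⊤ e₁)
    (he₂ : IsFrame (fun u v : E₂ => (scaledMetric g₂ (ρ₁ p.1) (ρ₁.pos p.1)).inner p.2 u v) ⊤ e₂) :
    IsFrame (fun u v => (doublyWarpedMetric g₁ g₂ ρ₁ ρ₂).inner p u v) ⊤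
      (Sum.elim (fun i => ((e₁ i, 0) : E₁ × E₂)) fun j => ((0, e₂ j) : E₁ × E₂)) :=
  (IsFrame.inl g₁ g₂ ρ₁ ρ₂ p he₁).sumElim (IsFrame.inr g₁ g₂ ρ₁ ρ₂ p he₂)
    (isBilinear_inner _ p) (leafTangent₁_sup_leafTangent₂ p)
    (fun _ hu _ hv => inner_leafTangent₁_leafTangent₂ g₁ g₂ ρ₁ ρ₂ p hu hv)
    (fun _ hu _ hv => ((doublyWarpedMetric g₁ g₂ ρ₁ ρ₂).symm p _ _).trans
      (inner_leafTangent₁_leafTangent₂ g₁ g₂ ρ₁ ρ₂ p hu hv))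

variable {F : Type*} [NormedAddCommGroup F] [NormedSpace ℝ F] [FiniteDimensional ℝ F]
  {K : Type*} [TopologicalSpace K] {J : ModelWithCorners ℝ F K} [J.Boundaryless]
  {N : Type*} [TopologicalSpace N] [ChartedSpace K N] [IsManifold J ∞ N]
  {g₁ g₂ ρ₁ ρ₂} {h : RiemMetric J N} {x : M₁ × M₂ → N}
  {ι κ : Type*} [Fintype ι] [Fintype κ] {e₁ : ι → E₁} {e₂ : κ → E₂}

theorem scalarCurvature_tangentImage_sub
    (hx : IsIsometricImmersion (doublyWarpedMetric g₁ g₂ ρ₁ ρ₂) h x)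
    (he₁ : IsFrame (fun u v : E₁ => (scaledMetric g₁ (ρ₂ p.2) (ρ₂.pos p.2)).inner p.1 u v) ⊤ e₁)
    (he₂ : IsFrame (fun u v : E₂ => (scaledMetric g₂ (ρ₁ p.1) (ρ₁.pos p.1)).inner p.2 u v) ⊤ e₂) :
    scalarCurvature h (x p) (tangentImage (I₁.prod I₂) J x p ⊤)
        - scalarCurvature h (x p) (tangentImage (I₁.prod I₂) J x p (leafTangent₁ I₁ I₂ p))
        - scalarCurvature h (x p) (tangentImage (I₁.prod I₂) J x p (leafTangent₂ I₁ I₂ p))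
      = ∑ i, ∑ j, h.inner (x p) (riemannCurvature h (x p)
          (mfderiv (I₁.prod I₂) J x p ((e₁ i, 0) : E₁ × E₂))
          (mfderiv (I₁.prod I₂) J x p ((0, e₂ j) : E₁ × E₂))
          (mfderiv (I₁.prod I₂) J x p ((0, e₂ j) : E₁ × E₂)))
          (mfderiv (I₁.prod I₂) J x p ((e₁ i, 0) : E₁ × E₂)) := by
  have h₁ := IsFrame.tangentImage hx (IsFrame.inl g₁ g₂ ρ₁ ρ₂ p he₁)
  have h₂ := IsFrame.tangentImage hx (IsFrame.inr g₁ g₂ ρ₁ ρ₂ p he₂)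
  have h₀ := IsFrame.tangentImage hx (IsFrame.sumElim_inl_inr g₁ g₂ ρ₁ ρ₂ p he₁ he₂)
  exact scalarCurvature_sub_sub h (x p) h₀ h₁ h₂ (fun _ => rfl) fun _ => rfl

variable [I₁.Boundaryless] [I₂.Boundaryless]

theorem hessian_scaledMetric (g : RiemMetric I₁ M₁) {c : ℝ} (hc : 0 < c) (ψ : M₁ → ℝ) (q : M₁)
    (u v : TangentSpace I₁ q) :
    hessian (scaledMetric g c hc) ψ q u v
      = chartHessian (metricInChart g q) (ψ ∘ (extChartAt I₁ q).symm) (extChartAt I₁ q q) u v := by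
  unfold hessian chartHessian
  rw [christoffelAt_scaledMetric]
  rfl

/-- The mixed sectional curvatures of a doubly warped product. -/
theorem inner_riemannCurvature_mixed {u : E₁} {v : E₂}
    (hu : (scaledMetric g₁ (ρ₂ p.2) (ρ₂.pos p.2)).inner p.1 u u = 1)
    (hv : (scaledMetric g₂ (ρ₁ p.1) (ρ₁.pos p.1)).inner p.2 v v = 1) :
    (doublyWarpedMetric g₁ g₂ ρ₁ ρ₂).inner p
        (riemannCurvature (doublyWarpedMetric g₁ g₂ ρ₁ ρ₂) p ((u, 0) : E₁ × E₂)
          ((0, v) : E₁ × E₂) ((0, v) : E₁ × E₂)) ((u, 0) : E₁ × E₂)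
      = -(hessian (scaledMetric g₁ (ρ₂ p.2) (ρ₂.pos p.2)) ρ₁ p.1 u u / ρ₁ p.1)
        - hessian (scaledMetric g₂ (ρ₁ p.1) (ρ₁.pos p.1)) ρ₂ p.2 v v / ρ₂ p.2 := by
  have h := (isDoublyWarpedNear_metricInChart g₁ g₂ ρ₁ ρ₂ p).apply_chartCurvature_mixed u v
  have p₁ := ρ₁.pos p.1
  have p₂ := ρ₂.pos p.2
  have y₁ : (extChartAt (I₁.prod I₂) p p).1 = extChartAt I₁ p.1 p.1 := by
    rw [extChartAt_prod]
    rfl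
  have y₂ : (extChartAt (I₁.prod I₂) p p).2 = extChartAt I₂ p.2 p.2 := by
    rw [extChartAt_prod]
    rfl
  have hu' : ρ₂ p.2 ^ 2 * g₁.inner p.1 u u = 1 := hu
  have hv' : ρ₁ p.1 ^ 2 * g₂.inner p.2 v v = 1 := hv
  rw [y₁, y₂, metricInChart_self g₁, metricInChart_self g₂, Function.comp_apply, Function.comp_apply,
    extChartAt_to_inv, extChartAt_to_inv] at h
  rw [hessian_scaledMetric g₁ (ρ₂.pos p.2) ρ₁ p.1 u u,
    hessian_scaledMetric g₂ (ρ₁.pos p.1) ρ₂ p.2 v v]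
  refine (inner_riemannCurvature _ p _ _ _ _).trans (h.trans ?_)
  have hu'' : g₁.inner p.1 u u = 1 / ρ₂ p.2 ^ 2 := by
    field_simp
    linarith
  have hv'' : g₂.inner p.2 v v = 1 / ρ₁ p.1 ^ 2 := by
    field_simp
    linarith
  rw [hu'', hv'']
  field_simp

theorem sum_secondFundamentalForm_leafTangent₁
    (hx : IsIsometricImmersion (doublyWarpedMetric g₁ g₂ ρ₁ ρ₂) h x)
    (he₁ : IsFrame (fun u v : E₁ => (scaledMetric g₁ (ρ₂ p.2) (ρ₂.pos p.2)).inner p.1 u v) ⊤ e₁) :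
    (Module.finrank ℝ E₁ : ℝ) •
        partialMeanCurvature (doublyWarpedMetric g₁ g₂ ρ₁ ρ₂) h x p (leafTangent₁ I₁ I₂ p)
      = ∑ i, secondFundamentalForm (doublyWarpedMetric g₁ g₂ ρ₁ ρ₂) h x p
          ((e₁ i, 0) : E₁ × E₂) ((e₁ i, 0) : E₁ × E₂) := by
  rw [← finrank_leafTangent₁ (I₁ := I₁) (I₂ := I₂) p]
  exact finrank_smul_partialMeanCurvature hx (.inl g₁ g₂ ρ₁ ρ₂ p he₁)

theorem sum_secondFundamentalForm_leafTangent₂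
    (hx : IsIsometricImmersion (doublyWarpedMetric g₁ g₂ ρ₁ ρ₂) h x)
    (he₂ : IsFrame (fun u v : E₂ => (scaledMetric g₂ (ρ₁ p.1) (ρ₁.pos p.1)).inner p.2 u v) ⊤ e₂) :
    (Module.finrank ℝ E₂ : ℝ) •
        partialMeanCurvature (doublyWarpedMetric g₁ g₂ ρ₁ ρ₂) h x p (leafTangent₂ I₁ I₂ p)
      = ∑ j, secondFundamentalForm (doublyWarpedMetric g₁ g₂ ρ₁ ρ₂) h x p
          ((0, e₂ j) : E₁ × E₂) ((0, e₂ j) : E₁ × E₂) := by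
  rw [← finrank_leafTangent₂ (I₁ := I₁) (I₂ := I₂) p]
  exact finrank_smul_partialMeanCurvature hx (.inr g₁ g₂ ρ₁ ρ₂ p he₂)

theorem finrank_smul_meanCurvature
    (hx : IsIsometricImmersion (doublyWarpedMetric g₁ g₂ ρ₁ ρ₂) h x)
    (he₁ : IsFrame (fun u v : E₁ => (scaledMetric g₁ (ρ₂ p.2) (ρ₂.pos p.2)).inner p.1 u v) ⊤ e₁)
    (he₂ : IsFrame (fun u v : E₂ => (scaledMetric g₂ (ρ₁ p.1) (ρ₁.pos p.1)).inner p.2 u v) ⊤ e₂) :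
    ((Module.finrank ℝ E₁ : ℝ) + Module.finrank ℝ E₂) •
        meanCurvature (doublyWarpedMetric g₁ g₂ ρ₁ ρ₂) h x p
      = ∑ i, secondFundamentalForm (doublyWarpedMetric g₁ g₂ ρ₁ ρ₂) h x p
          ((e₁ i, 0) : E₁ × E₂) ((e₁ i, 0) : E₁ × E₂)
        + ∑ j, secondFundamentalForm (doublyWarpedMetric g₁ g₂ ρ₁ ρ₂) h x p
          ((0, e₂ j) : E₁ × E₂) ((0, e₂ j) : E₁ × E₂) := by
  have h1 := finrank_smul_partialMeanCurvature hx (.sumElim_inl_inr g₁ g₂ ρ₁ ρ₂ p he₁ he₂)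
  have h2 : (Module.finrank ℝ (⊤ : Submodule ℝ (TangentSpace (I₁.prod I₂) p)) : ℝ)
      = Module.finrank ℝ E₁ + Module.finrank ℝ E₂ := by
    rw [finrank_top]
    exact_mod_cast Module.finrank_prod (R := ℝ) (M := E₁) (M' := E₂)
  rw [h2, Fintype.sum_sum_type] at h1
  exact h1

theorem warpingTerm_eq :
    warpingTerm g₁ g₂ ρ₁ ρ₂ p
      = ∑ i, ∑ j, (doublyWarpedMetric g₁ g₂ ρ₁ ρ₂).inner p
          (riemannCurvature (doublyWarpedMetric g₁ g₂ ρ₁ ρ₂) p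
            ((orthonormalFrame (scaledMetric g₁ (ρ₂ p.2) (ρ₂.pos p.2)) p.1 ⊤ i, 0) : E₁ × E₂)
            ((0, orthonormalFrame (scaledMetric g₂ (ρ₁ p.1) (ρ₁.pos p.1)) p.2 ⊤ j) : E₁ × E₂)
            ((0, orthonormalFrame (scaledMetric g₂ (ρ₁ p.1) (ρ₁.pos p.1)) p.2 ⊤ j) : E₁ × E₂))
          ((orthonormalFrame (scaledMetric g₁ (ρ₂ p.2) (ρ₂.pos p.2)) p.1 ⊤ i, 0) : E₁ × E₂) := by
  have f₁ := isFrame_orthonormalFrame (scaledMetric g₁ (ρ₂ p.2) (ρ₂.pos p.2)) p.1 ⊤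
  have f₂ := isFrame_orthonormalFrame (scaledMetric g₂ (ρ₁ p.1) (ρ₁.pos p.1)) p.2 ⊤
  rw [Finset.sum_congr rfl fun i _ => Finset.sum_congr rfl fun j _ =>
    inner_riemannCurvature_mixed (g₁ := g₁) (g₂ := g₂) (ρ₁ := ρ₁) (ρ₂ := ρ₂) p (f₁.apply_self i) (f₂.apply_self j)]
  have c₁ : Module.finrank ℝ (TangentSpace I₁ p.1) = Module.finrank ℝ E₁ := rfl
  have c₂ : Module.finrank ℝ (TangentSpace I₂ p.2) = Module.finrank ℝ E₂ := rfl
  simp only [warpingTerm, leafLaplacian₁, leafLaplacian₂, laplacian, Finset.sum_sub_distrib,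
    Finset.sum_const, Finset.card_univ, Fintype.card_fin, finrank_top, c₁, c₂, nsmul_eq_mul,
    ← Finset.mul_sum, Finset.sum_neg_distrib, ← Finset.sum_div]
  ring

theorem extrinsicTerm_sub_warpingTerm
    (hx : IsIsometricImmersion (doublyWarpedMetric g₁ g₂ ρ₁ ρ₂) h x)
    (he₁ : IsFrame (fun u v : E₁ => (scaledMetric g₁ (ρ₂ p.2) (ρ₂.pos p.2)).inner p.1 u v) ⊤ e₁)
    (he₂ : IsFrame (fun u v : E₂ => (scaledMetric g₂ (ρ₁ p.1) (ρ₁.pos p.1)).inner p.2 u v) ⊤ e₂)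
    (hw : warpingTerm g₁ g₂ ρ₁ ρ₂ p = ∑ i, ∑ j, (doublyWarpedMetric g₁ g₂ ρ₁ ρ₂).inner p
      (riemannCurvature (doublyWarpedMetric g₁ g₂ ρ₁ ρ₂) p ((e₁ i, 0) : E₁ × E₂)
        ((0, e₂ j) : E₁ × E₂) ((0, e₂ j) : E₁ × E₂)) ((e₁ i, 0) : E₁ × E₂)) :
    extrinsicTerm (doublyWarpedMetric g₁ g₂ ρ₁ ρ₂) h x p - warpingTerm g₁ g₂ ρ₁ ρ₂ p
      = 1 / 4 * h.inner (x p)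
          ((Module.finrank ℝ E₁ : ℝ) •
              partialMeanCurvature (doublyWarpedMetric g₁ g₂ ρ₁ ρ₂) h x p (leafTangent₁ I₁ I₂ p)
            - (Module.finrank ℝ E₂ : ℝ) •
              partialMeanCurvature (doublyWarpedMetric g₁ g₂ ρ₁ ρ₂) h x p (leafTangent₂ I₁ I₂ p))
          ((Module.finrank ℝ E₁ : ℝ) •
              partialMeanCurvature (doublyWarpedMetric g₁ g₂ ρ₁ ρ₂) h x p (leafTangent₁ I₁ I₂ p)
            - (Module.finrank ℝ E₂ : ℝ) •
              partialMeanCurvature (doublyWarpedMetric g₁ g₂ ρ₁ ρ₂) h x p (leafTangent₂ I₁ I₂ p))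
        + ∑ i, ∑ j, h.inner (x p)
          (secondFundamentalForm (doublyWarpedMetric g₁ g₂ ρ₁ ρ₂) h x p
            ((e₁ i, 0) : E₁ × E₂) ((0, e₂ j) : E₁ × E₂))
          (secondFundamentalForm (doublyWarpedMetric g₁ g₂ ρ₁ ρ₂) h x p
            ((e₁ i, 0) : E₁ × E₂) ((0, e₂ j) : E₁ × E₂)) := by
  have hτ := scalarCurvature_tangentImage_sub p hx he₁ he₂
  have hH := finrank_smul_meanCurvature p hx he₁ he₂
  rw [sum_secondFundamentalForm_leafTangent₁ p hx he₁,
    sum_secondFundamentalForm_leafTangent₂ p hx he₂, hw]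
  have hnorm : ((Module.finrank ℝ E₁ : ℝ) + Module.finrank ℝ E₂) ^ 2
      * h.inner (x p) (meanCurvature (doublyWarpedMetric g₁ g₂ ρ₁ ρ₂) h x p)
        (meanCurvature (doublyWarpedMetric g₁ g₂ ρ₁ ρ₂) h x p)
      = h.inner (x p) (((Module.finrank ℝ E₁ : ℝ) + Module.finrank ℝ E₂) •
          meanCurvature (doublyWarpedMetric g₁ g₂ ρ₁ ρ₂) h x p)
        (((Module.finrank ℝ E₁ : ℝ) + Module.finrank ℝ E₂) •
          meanCurvature (doublyWarpedMetric g₁ g₂ ρ₁ ρ₂) h x p) := by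
    simp only [map_smul, smul_apply, smul_eq_mul]
    ring
  rw [hH] at hnorm
  have hgauss (i : ι) (j : κ) := hx.gauss_equation p ((e₁ i, 0) : E₁ × E₂) ((0, e₂ j) : E₁ × E₂)
    ((0, e₂ j) : E₁ × E₂) ((e₁ i, 0) : E₁ × E₂)
  simp only [hx.secondFundamentalForm_symm p ((0, e₂ _) : E₁ × E₂) ((e₁ _, 0) : E₁ × E₂)] at hgauss
  simp only [hgauss, Finset.sum_add_distrib, Finset.sum_sub_distrib]
  have hAB : ∑ i, ∑ j, h.inner (x p)
        (secondFundamentalForm (doublyWarpedMetric g₁ g₂ ρ₁ ρ₂) h x p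
          ((e₁ i, 0) : E₁ × E₂) ((e₁ i, 0) : E₁ × E₂))
        (secondFundamentalForm (doublyWarpedMetric g₁ g₂ ρ₁ ρ₂) h x p
          ((0, e₂ j) : E₁ × E₂) ((0, e₂ j) : E₁ × E₂))
      = h.inner (x p) (∑ i, secondFundamentalForm (doublyWarpedMetric g₁ g₂ ρ₁ ρ₂) h x p
          ((e₁ i, 0) : E₁ × E₂) ((e₁ i, 0) : E₁ × E₂))
        (∑ j, secondFundamentalForm (doublyWarpedMetric g₁ g₂ ρ₁ ρ₂) h x p
          ((0, e₂ j) : E₁ × E₂) ((0, e₂ j) : E₁ × E₂)) := by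
    simp only [map_sum, sum_apply]
    rw [Finset.sum_comm]
  rw [hAB]
  unfold extrinsicTerm
  generalize ∑ i, secondFundamentalForm (doublyWarpedMetric g₁ g₂ ρ₁ ρ₂) h x p
    ((e₁ i, 0) : E₁ × E₂) ((e₁ i, 0) : E₁ × E₂) = A at *
  generalize ∑ j, secondFundamentalForm (doublyWarpedMetric g₁ g₂ ρ₁ ρ₂) h x p
    ((0, e₂ j) : E₁ × E₂) ((0, e₂ j) : E₁ × E₂) = B at *
  have hs := h.symm (x p) A B
  simp only [map_add, map_sub, add_apply, sub_apply] at hnorm ⊢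
  linarith

theorem secondFundamentalForm_mixed_eq_zero_iff
    (hx : IsIsometricImmersion (doublyWarpedMetric g₁ g₂ ρ₁ ρ₂) h x)
    (he₁ : IsFrame (fun u v : E₁ => (scaledMetric g₁ (ρ₂ p.2) (ρ₂.pos p.2)).inner p.1 u v) ⊤ e₁)
    (he₂ : IsFrame (fun u v : E₂ => (scaledMetric g₂ (ρ₁ p.1) (ρ₁.pos p.1)).inner p.2 u v) ⊤ e₂) :
    (∀ X ∈ leafTangent₁ I₁ I₂ p, ∀ Z ∈ leafTangent₂ I₁ I₂ p,
        secondFundamentalForm (doublyWarpedMetric g₁ g₂ ρ₁ ρ₂) h x p X Z = 0) ↔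
      ∀ i j, secondFundamentalForm (doublyWarpedMetric g₁ g₂ ρ₁ ρ₂) h x p
        ((e₁ i, 0) : E₁ × E₂) ((0, e₂ j) : E₁ × E₂) = 0 := by
  have f₁ := IsFrame.inl g₁ g₂ ρ₁ ρ₂ p he₁
  have f₂ := IsFrame.inr g₁ g₂ ρ₁ ρ₂ p he₂
  exact ⟨fun H i j => H _ (f₁.mem i) _ (f₂.mem j), fun H X hX Z hZ =>
    f₁.bilinear_eq_zero f₂ (hx.isBilinear p) H hX hZ⟩

/-- The pointwise form of the inequality, with its equality case. -/
theorem warpingTerm_le_extrinsicTerm_and_eq_iff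
    (hx : IsIsometricImmersion (doublyWarpedMetric g₁ g₂ ρ₁ ρ₂) h x) :
    warpingTerm g₁ g₂ ρ₁ ρ₂ p ≤ extrinsicTerm (doublyWarpedMetric g₁ g₂ ρ₁ ρ₂) h x p ∧
      (warpingTerm g₁ g₂ ρ₁ ρ₂ p = extrinsicTerm (doublyWarpedMetric g₁ g₂ ρ₁ ρ₂) h x p ↔
        (∀ X ∈ leafTangent₁ I₁ I₂ p, ∀ Z ∈ leafTangent₂ I₁ I₂ p,
          secondFundamentalForm (doublyWarpedMetric g₁ g₂ ρ₁ ρ₂) h x p X Z = 0) ∧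
        (Module.finrank ℝ E₁ : ℝ) •
            partialMeanCurvature (doublyWarpedMetric g₁ g₂ ρ₁ ρ₂) h x p (leafTangent₁ I₁ I₂ p)
          = (Module.finrank ℝ E₂ : ℝ) •
            partialMeanCurvature (doublyWarpedMetric g₁ g₂ ρ₁ ρ₂) h x p (leafTangent₂ I₁ I₂ p)) := by
  have he₁ := isFrame_orthonormalFrame (scaledMetric g₁ (ρ₂ p.2) (ρ₂.pos p.2)) p.1 ⊤
  have he₂ := isFrame_orthonormalFrame (scaledMetric g₂ (ρ₁ p.1) (ρ₁.pos p.1)) p.2 ⊤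
  have key := extrinsicTerm_sub_warpingTerm p hx he₁ he₂ (warpingTerm_eq p)
  rw [secondFundamentalForm_mixed_eq_zero_iff p hx he₁ he₂]
  have n₁ := fun i j => RiemMetric.inner_self_nonneg h (x p)
    (secondFundamentalForm (doublyWarpedMetric g₁ g₂ ρ₁ ρ₂) h x p
      ((orthonormalFrame (scaledMetric g₁ (ρ₂ p.2) (ρ₂.pos p.2)) p.1 ⊤ i, 0) : E₁ × E₂)
      ((0, orthonormalFrame (scaledMetric g₂ (ρ₁ p.1) (ρ₁.pos p.1)) p.2 ⊤ j) : E₁ × E₂))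
  have n₂ := RiemMetric.inner_self_nonneg h (x p)
    ((Module.finrank ℝ E₁ : ℝ) •
        partialMeanCurvature (doublyWarpedMetric g₁ g₂ ρ₁ ρ₂) h x p (leafTangent₁ I₁ I₂ p)
      - (Module.finrank ℝ E₂ : ℝ) •
        partialMeanCurvature (doublyWarpedMetric g₁ g₂ ρ₁ ρ₂) h x p (leafTangent₂ I₁ I₂ p))
  have n₃ := Finset.sum_nonneg fun i (_ : i ∈ Finset.univ) =>
    Finset.sum_nonneg fun j (_ : j ∈ Finset.univ) => n₁ i j
  refine ⟨by linarith, fun H => ⟨fun i j => ?_, ?_⟩, fun H => ?_⟩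
  · have h0 := (Finset.sum_eq_zero_iff_of_nonneg fun i (_ : i ∈ Finset.univ) =>
      Finset.sum_nonneg fun j (_ : j ∈ Finset.univ) => n₁ i j).mp (by linarith) i (Finset.mem_univ i)
    exact (RiemMetric.inner_self_eq_zero h).mp
      ((Finset.sum_eq_zero_iff_of_nonneg fun j _ => n₁ i j).mp h0 j (Finset.mem_univ j))
  · rw [← sub_eq_zero]
    exact (RiemMetric.inner_self_eq_zero h).mp (by linarith)
  · rw [sub_eq_zero.mpr H.2] at key
    simp only [H.1, map_zero, Finset.sum_const_zero] at key
    linarith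

end LeafTangents

end

theorem mainTheorem1
    {E₁ : Type*} [NormedAddCommGroup E₁] [NormedSpace ℝ E₁] [FiniteDimensional ℝ E₁]
    {M₁ : Type*} [TopologicalSpace M₁] [ChartedSpace E₁ M₁] [IsManifold 𝓘(ℝ, E₁) ∞ M₁]
    {E₂ : Type*} [NormedAddCommGroup E₂] [NormedSpace ℝ E₂] [FiniteDimensional ℝ E₂]
    {M₂ : Type*} [TopologicalSpace M₂] [ChartedSpace E₂ M₂] [IsManifold 𝓘(ℝ, E₂) ∞ M₂]
    {F : Type*} [NormedAddCommGroup F] [NormedSpace ℝ F] [FiniteDimensional ℝ F]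
    {N : Type*} [TopologicalSpace N] [ChartedSpace F N] [IsManifold 𝓘(ℝ, F) ∞ N]
    (g₁ : RiemMetric 𝓘(ℝ, E₁) M₁) (g₂ : RiemMetric 𝓘(ℝ, E₂) M₂) (h : RiemMetric 𝓘(ℝ, F) N)
    (ρ₁ : WarpingFunction 𝓘(ℝ, E₁) M₁) (ρ₂ : WarpingFunction 𝓘(ℝ, E₂) M₂)
    (x : M₁ × M₂ → N) (hx : IsIsometricImmersion (doublyWarpedMetric g₁ g₂ ρ₁ ρ₂) h x) :
    (∀ p, warpingTerm g₁ g₂ ρ₁ ρ₂ p ≤ extrinsicTerm (doublyWarpedMetric g₁ g₂ ρ₁ ρ₂) h x p) ∧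
    ((∀ p, warpingTerm g₁ g₂ ρ₁ ρ₂ p = extrinsicTerm (doublyWarpedMetric g₁ g₂ ρ₁ ρ₂) h x p) ↔
      IsMixedTotallyGeodesic (doublyWarpedMetric g₁ g₂ ρ₁ ρ₂) h x ∧
      HasEqualPartialMeanCurvatures (doublyWarpedMetric g₁ g₂ ρ₁ ρ₂) h x) := by
  have H := fun p => warpingTerm_le_extrinsicTerm_and_eq_iff p hx
  exact ⟨fun p => (H p).1, fun h0 => ⟨fun p => ((H p).2.mp (h0 p)).1, fun p => ((H p).2.mp (h0 p)).2⟩,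
    fun h0 p => (H p).2.mpr ⟨h0.1 p, h0.2 p⟩⟩
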